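/- **Setting.** Let $\mathcal X,\mathcal A$ be finite non-empty sets, $T,H\ge 1$, and for $h\in[H]$ let $\mathcal F^h$ be a finite non-empty class of functions $\mathcal X\times\mathcal A\to[0,L]$, $\mathcal N=\max_h|\mathcal F^h|$. Fix $\lambda>0$. A weighted dataset $\mathcal Z$ is a finite multiset of pairs $(z,\sigma)$, $z\in\mathcal X\times\mathcal A$, $\sigma>0$; put $\|g\|_{\mathcal Z}^2=\sum_{(z,\sigma)\in\mathcal Z}g(z)^2/\sigma^2$ and $$D_{\mathcal F}^2(z;\mathcal Z)=\sup_{f_1,f_2\in\mathcal F}\frac{(f_1(z)-f_2(z))^2}{\|f_1-f_2\|_{\mathcal Z}^2+\lambda},\qquad \dim_{\alpha,T}(\mathcal F)=\sup\ \sum_{i=1}^T\min\Bigl(1,\tfrac1{\sigma_i^2}D^2_{\mathcal F}\bigl(z_i;\{(z_s,\sigma_s)\}_{s<i}\bigr)\Bigr),$$ the last supremum being over all $z_1,\dots,z_T$ and all $\sigma_1,\dots,\sigma_T\ge\alpha$. Let $\alpha\ge\sqrt{1/(TH)}$ and $0<\delta<1/(H^2+11)$. **Radii.** Let $0\le\beta_1^h\le\dots\le\beta_T^h$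 be the confidence radii at level $h$, and let $\beta^h$ be the radius parameter of the sub-sampling at level $h$, where, for a constant $K\ge1$, $\beta_t^h\le\beta^h$, $\lambda\le(\beta^h)^2$ and $(\beta^h)^2\le K\bigl((\beta_t^h)^2+\lambda\bigr)$ for all $t\in[T]$. (For example $\beta_t^h=\beta^h\ge\sqrt\lambda$ for all $t$, with $K=1$.) **Online sensitivity sub-sampling.** At each step $t$ and level $h$ a pair $(z_t^h,\bar\sigma_t^h)$ with $\bar\sigma_t^h\ge\alpha$ arrives, which may depend arbitrarily on everything that happened before the coins of step $t$, including all earlier coins. Let $\mathcal Z^h_{[t-1]}=\{(z^h_s,\bar\sigma^h_s)\}_{s<t}$ be the original data and $\hat{\mathcal Z}_{[t-1]}^h$ the current sub-sample, with $\hat{\mathcal Z}^h_{[0]}=\emptyset$. Let $\mathcal R$ be either always $\hat{\mathcal Z}^h_{[t-1]}$ or always $\mathcal Z_{[t-1]}^h$ (the result holds for both versions of the algorithm), let $$\mathrm{sens}=\min\Bigl\{1,\ \sup_{f,f'\in\mathcal F^h}\frac{(f(z_t^h)-f'(z_t^h))^2/(\bar\sigma_t^h)^2}{\min\{\|f-f'\|^2_{\mathcal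 R},\,T(H+1)^2/\alpha^2\}+(\beta^h)^2}\Bigr\},$$ and let $p$ be the smallest real with $1/p\in\mathbb Z$ and $p\ge\min\bigl(1,C_{\rm alg}\cdot\mathrm{sens}\cdot\log(T\mathcal N/\delta)\bigr)$ ($p=0$ if $\mathrm{sens}=0$). With conditional probability $p$ given the past, add $1/p$ copies of $(z_t^h,\bar\sigma_t^h)$ to $\hat{\mathcal Z}_{[t-1]}^h$ to get $\hat{\mathcal Z}_{[t]}^h$; otherwise $\hat{\mathcal Z}_{[t]}^h=\hat{\mathcal Z}_{[t-1]}^h$. The bonus at iteration $t$ is $$b_t^h(z)=\max\Bigl\{|f_1(z)-f_2(z)|:\ f_1,f_2\in\mathcal F^h,\ \sum_{(z',\sigma)\in\hat{\mathcal Z}_{[t-1]}^h}\rho(\sigma)\,(f_1(z')-f_2(z'))^2\le 10^2(\beta^h)^2\Bigr\},$$ where $\rho(\sigma)$ is $1/\sigma^2$ rounded down to an integer power of two, and $\rho(\sigma)=0$ if $1/\sigma^2<\lambda/(TL^2)$. **Claim.** There are constants $C_{\rm alg}\ge1$ and $C_{\mathcal W}>0$ depending only on $L,\lambda$, and $C>0$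 depending only on $L,\lambda,K$, such that, for all data as above, there is a finite class $\mathcal W$ of functions on $\mathcal X\times\mathcal A$, not depending on the data process, with $$\log|\mathcal W|\le C_{\mathcal W}\cdot\max\bigl\{1,\max_{h\in[H]}\dim_{\alpha,T}(\mathcal F^h)\bigr\}\cdot\log\frac{T\mathcal N}{\delta}\cdot\log\frac{T|\mathcal X\times\mathcal A|}{\delta},$$ and for every adaptive data process, with probability at least $1-\delta$, the $b_t^h$ are the outputs of a consistent bonus oracle with error $\varepsilon_{\rm b}=0$, simultaneously for all $t\in[T]$, $h\in[H]$. That is, for all $t\in[T]$, $h\in[H]$, $z\in\mathcal X\times\mathcal A$ and every centre $\hat f\in\mathcal F^h$: 1. $b_t^h\in\mathcal W$ and $b_t^h\ge0$; 2. $b_t^h(z)\ge|f(z)-\hat f(z)|$ for every $f\in\mathcal F^h$ with $\|f-\hat f\|^2_{\mathcal Z_{[t-1]}^h}\le(\beta_t^h)^2$; 3. $b_t^h(z)\le C\cdot D_{\mathcal F^h}(z;\mathcal Z_{[t-1]}^h)\sqrt{(\beta_t^h)^2+\lambda}$; 4. (consistency) $b_{t'}^h(z)\le b_t^h(z)$ for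 all $t<t'\le T$. -/

import Mathlib

noncomputable section

namespace BonusOracle

/-- A weighted dataset over `Z`: a finite multiset of pairs `(z, σ(z))`. -/
abbrev WData (Z : Type*) := Multiset (Z × ℝ)

/-- `‖g‖²_𝒵 = ∑_{(z,σ) ∈ 𝒵} g(z)² / σ²`. -/
def wnormSq {Z : Type*} (D : WData Z) (g : Z → ℝ) : ℝ :=
  (D.map fun p => (g p.1) ^ 2 / p.2 ^ 2).sum

/-- The first `t` observations `(w 0, …, w (t-1))` of a sequence, as a weighted dataset. -/
def prefixData {Z : Type*} (w : ℕ → Z × ℝ) (t : ℕ) : WData Z :=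
  (Multiset.range t).map w

/-- `D²_F(z; 𝒵) = sup_{f₁,f₂ ∈ F} (f₁(z) - f₂(z))² / (‖f₁ - f₂‖²_𝒵 + λ)`. -/
def uncertaintySq {Z : Type*} (F : Finset (Z → ℝ)) (lam : ℝ) (D : WData Z) (z : Z) : ℝ :=
  ⨆ f : F × F, (f.1.1 z - f.2.1 z) ^ 2 / (wnormSq D (f.1.1 - f.2.1) + lam)

/-- `D_F(z; 𝒵)`, the square root of `D²_F(z; 𝒵)`. -/
def uncertainty {Z : Type*} (F : Finset (Z → ℝ)) (lam : ℝ) (D : WData Z) (z : Z) : ℝ :=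
  Real.sqrt (uncertaintySq F lam D z)

/-- `dim(F, Z, σ)` for a sequence `w i = (z_i, σ_i)`, `i < T`. -/
def eluderSum {Z : Type*} (F : Finset (Z → ℝ)) (lam : ℝ) (T : ℕ) (w : ℕ → Z × ℝ) : ℝ :=
  ∑ i ∈ Finset.range T,
    min 1 (1 / (w i).2 ^ 2 * uncertaintySq F lam (prefixData w i) (w i).1)

/-- Generalized Eluder dimension `dim_{α,T}(F)`: the supremum of `dim(F, Z, σ)` over all sequences
with `σ ≥ α`. Every `dim(F, Z, σ)` is at most `T`, so the supremum is a finite one. -/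
def genEluderDim {Z : Type*} (F : Finset (Z → ℝ)) (lam α : ℝ) (T : ℕ) : ℝ :=
  ⨆ w : {w : ℕ → Z × ℝ // ∀ i, α ≤ (w i).2}, eluderSum F lam T w.1

/-- `𝒩 = max_h |F^h|`. -/
def maxCard {Z : Type*} {H : ℕ} (F : Fin H → Finset (Z → ℝ)) : ℕ :=
  Finset.univ.sup fun h => (F h).card

/-- Numerical inputs of the sub-sampling algorithm: number of episodes `T`, horizon `H`, size `N` of
the function class, oversampling constant `C`, radius `β`, threshold `α`, failure probability `δ`. -/
structure Params where
  T : ℕ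
  H : ℕ
  N : ℕ
  C : ℝ
  β : ℝ
  α : ℝ
  δ : ℝ

/-- Weighted sensitivity score of `(z, σ)` relative to the weighted dataset `D`. -/
def sensitivity {Z : Type*} (P : Params) (F : Finset (Z → ℝ)) (D : WData Z) (z : Z) (σ : ℝ) : ℝ :=
  min (⨆ f : F × F, 1 / σ ^ 2 * (f.1.1 z - f.2.1 z) ^ 2 /
      (min (wnormSq D (f.1.1 - f.2.1)) (P.T * (P.H + 1) ^ 2 / P.α ^ 2) + P.β ^ 2)) 1

/-- `min(1, C · sensitivity · log(TN/δ))`. -/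
def targetProb {Z : Type*} (P : Params) (F : Finset (Z → ℝ)) (D : WData Z) (z : Z) (σ : ℝ) : ℝ :=
  min 1 (P.C * sensitivity P F D z σ * Real.log (P.T * P.N / P.δ))

/-- The number `1/p` of copies, where `p` is the smallest real number `≥ q` such that `1/p` is an
integer (see `isLeast_invFloor`). For `q = 0` this gives `0` copies and `p = 0`: a point of
sensitivity zero is never added. -/
def copies (q : ℝ) : ℕ := ⌊1 / q⌋₊

theorem isLeast_invFloor {q : ℝ} (hq : 0 < q) (hq1 : q ≤ 1) :
    IsLeast {p : ℝ | 0 < p ∧ q ≤ p ∧ ∃ n : ℤ, 1 / p = n} (1 / (copies q : ℝ)) := by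
  have h1 : (1 : ℝ) ≤ 1 / q := by rw [le_div_iff₀ hq]; linarith
  have hn : 1 ≤ ⌊1 / q⌋₊ := Nat.le_floor (by exact_mod_cast h1)
  have hn' : (0 : ℝ) < (⌊1 / q⌋₊ : ℝ) := by exact_mod_cast hn
  have hfl : (⌊1 / q⌋₊ : ℝ) ≤ 1 / q := Nat.floor_le (by positivity)
  unfold copies
  refine ⟨⟨by positivity, ?_, (⌊1 / q⌋₊ : ℤ), by push_cast; simp⟩, ?_⟩
  · rw [le_div_iff₀ hn']
    rw [le_div_iff₀ hq] at hfl
    linarith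
  · rintro p ⟨hp, hqp, n, hpn⟩
    have hnpos : (0 : ℝ) < n := by rw [← hpn]; positivity
    have hnpos' : 0 < n := by exact_mod_cast hnpos
    have hle : 1 / p ≤ 1 / q := one_div_le_one_div_of_le hq hqp
    obtain ⟨m, rfl⟩ := Int.eq_ofNat_of_zero_le hnpos'.le
    have hm : m ≤ ⌊1 / q⌋₊ := Nat.le_floor (by rw [hpn] at hle; exact_mod_cast hle)
    have hm' : (m : ℝ) ≤ (⌊1 / q⌋₊ : ℝ) := by exact_mod_cast hm
    have hpm : p = 1 / (m : ℝ) := by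
      have : 1 / p = (m : ℝ) := by exact_mod_cast hpn
      rw [← this]; simp
    rw [hpm]
    exact one_div_le_one_div_of_le (by exact_mod_cast hnpos) hm'

/-- The dataset relative to which the sensitivity of a new point is computed: the original data
(`full = true`) or the current sub-sampled data (`full = false`). -/
def refData {Z : Type*} (full : Bool) (D Dhat : WData Z) : WData Z :=
  if full then D else Dhat

/-- Target sampling probability of the observation `w t`, given the current sub-sample `Dhat`. -/
def stepProb {Z : Type*} (P : Params) (F : Finset (Z → ℝ)) (full : Bool)
    (w : ℕ → Z × ℝ) (t : ℕ) (Dhat : WData Z) : ℝ :=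
  targetProb P F (refData full (prefixData w t) Dhat) (w t).1 (w t).2

open Classical in
/-- The online sub-sample obtained from the first `t` observations: `add s` says whether the
coin of step `s` came up "add", in which case `1/p` copies of `w s` are added. -/
def subsample {Z : Type*} (P : Params) (F : Finset (Z → ℝ)) (full : Bool)
    (w : ℕ → Z × ℝ) (add : ℕ → Prop) : ℕ → WData Z
  | 0 => 0
  | t + 1 =>
      if add t then
        subsample P F full w add t +
          Multiset.replicate
            (copies (stepProb P F full w t (subsample P F full w add t))) (w t)
      else subsample P F full w add t

/-- The probability `p` with which the observation `w t` is added to the sub-sample. -/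
def addProb {Z : Type*} (P : Params) (F : Finset (Z → ℝ)) (full : Bool)
    (w : ℕ → Z × ℝ) (add : ℕ → Prop) (t : ℕ) : ℝ :=
  1 / (copies (stepProb P F full w t (subsample P F full w add t)) : ℝ)

/-- The weight `1/σ²` rounded down to an integer power of two; weights below `κ` are dropped. -/
def roundedWeight (κ σ : ℝ) : ℝ :=
  if 1 / σ ^ 2 < κ then 0 else (2 : ℝ) ^ Int.log 2 (1 / σ ^ 2)

/-- `‖g‖²` over a weighted dataset, with rounded weights. -/
def roundedNormSq {Z : Type*} (κ : ℝ) (D : WData Z) (g : Z → ℝ) : ℝ :=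
  (D.map fun p => roundedWeight κ p.2 * (g p.1) ^ 2).sum

/-- The bonus computed from a sub-sampled dataset: the largest gap at `z` between two functions of
`F` whose (rounded) squared distance on the sub-sample is at most `10² β²`. -/
def subsampleBonus {Z : Type*} (F : Finset (Z → ℝ)) (κ β : ℝ) (Dhat : WData Z) (z : Z) : ℝ :=
  sSup {y : ℝ | ∃ f₁ ∈ F, ∃ f₂ ∈ F,
    roundedNormSq κ Dhat (f₁ - f₂) ≤ 10 ^ 2 * β ^ 2 ∧ y = |f₁ z - f₂ z|}

/-- The three requirements on the output `b` of a bonus oracle with bonus class `W`, constant `C`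
and error `εb`, called on the weighted dataset `D`, the class `F`, the centre `fhat` and the
radius `β`. -/
structure IsBonus {Z : Type*} (W : Finset (Z → ℝ)) (C lam εb : ℝ) (F : Finset (Z → ℝ))
    (D : WData Z) (fhat : Z → ℝ) (β : ℝ) (b : Z → ℝ) : Prop where
  mem : b ∈ W
  nonneg : ∀ z, 0 ≤ b z
  dominates : ∀ z, ∀ f ∈ F, wnormSq D (f - fhat) ≤ β ^ 2 → |f z - fhat z| ≤ b z
  le : ∀ z, b z ≤ C * (uncertainty F lam D z * Real.sqrt (β ^ 2 + lam) + εb * β)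

/-- Along one realization of the data (`w h s` is the `s`-th weighted observation at level `h`), the
bonuses `b h t` computed at the iterations `t < T` from the first `t` observations are valid outputs
of a bonus oracle, whatever the centre in `F h`, and are consistent, i.e. pointwise nonincreasing
in `t`. -/
structure IsConsistentBonusFamily {Z : Type*} {H : ℕ} (W : Finset (Z → ℝ)) (C lam εb : ℝ) (T : ℕ)
    (F : Fin H → Finset (Z → ℝ)) (w : Fin H → ℕ → Z × ℝ) (β : Fin H → ℕ → ℝ)
    (b : Fin H → ℕ → Z → ℝ) : Prop where
  isBonus : ∀ h, ∀ t < T, ∀ fhat ∈ F h,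
    IsBonus W C lam εb (F h) (prefixData (w h) t) fhat (β h t) (b h t)
  consistent : ∀ h t t', t < t' → t' < T → ∀ z, b h t' z ≤ b h t z

end BonusOracle

end

/-! The plan is to isolate one event on which the sub-sample is a faithful sketch of the data, to
derive every oracle property deterministically on that event, and to bound its complement by a union
bound over function pairs, scales, times and levels.

Faithfulness means that, for every pair in the class, the squared distance on the data and on the
sub-sample agree up to constant factors and an additive multiple of β². Each coin is unbiased: with
probability `1/n` it adds `n` copies. So an exponential supermartingale controls the sampled sums,
provided single increments are small. Smallness comes from the sensitivity score, but only if the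
current sub-sample is already under control, which is circular when the reference set is the
sub-sample. Moreover the natural bound scales with the random final norm of the data. Both problems
are met by truncation: the concentration is proved for increments cut off, predictably, at a
deterministic dyadic level (`IsGoodPath`), and strong induction over time along a good path shows
that the cut-off at the right level never acts (`wnormSq_subsample_le`). The matching lower bound is
`roundedNormSq_subsample_ge`.

These two bounds make the feasible set of the bonus contain every pair close on the data, and only
pairs at squared distance O(β²); hence domination and the upper bound by the uncertainty.
Consistency holds pathwise, because the sub-sample only grows while the radius stays fixed.

For the size of the bonus class, sensitivity is at most a constant times the uncertainty
(`sensitivity_le_uncertainty`). So the probabilities sum to the Eluder dimension times a logarithm,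
and the number of distinct sampled points is of that order (`card_added_le`). With rounded weights
and capped multiplicities, the bonus depends only on a short code (`subsampleBonus_mem_bonusClass`);
counting codes bounds the class. -/

namespace BonusOracle

open MeasureTheory

/-! ### Exponential concentration for sums driven by adaptive coins -/

section Concentration

variable {Ω : Type*} {mΩ : MeasurableSpace Ω} {μ : Measure Ω} [IsProbabilityMeasure μ]

theorem integrable_of_measurable_bounded {m : MeasurableSpace Ω} (hm : m ≤ mΩ) {f : Ω → ℝ}
    (hf : Measurable[m] f) {R : ℝ} (hR : ∀ ω, |f ω| ≤ R) : Integrable f μ :=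
  Integrable.of_bound (hf.mono hm le_rfl).aestronglyMeasurable R
    (Filter.Eventually.of_forall fun ω => by simpa using hR ω)

/-- The tower property against a coin with conditional success probability `p`. -/
theorem integral_mul_coin {m : MeasurableSpace Ω} (hm : m ≤ mΩ) {E : Set Ω}
    (hE : MeasurableSet[mΩ] E) {p ψ : Ω → ℝ}
    (hp : μ[E.indicator (fun _ => (1 : ℝ)) | m] =ᵐ[μ] p)
    (hψ : Measurable[m] ψ) {R : ℝ} (hR : ∀ ω, |ψ ω| ≤ R) :
    ∫ ω, ψ ω * E.indicator (fun _ => (1 : ℝ)) ω ∂μ = ∫ ω, ψ ω * p ω ∂μ := by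
  have hint : Integrable (E.indicator (fun _ => (1 : ℝ))) μ :=
    (integrable_const 1).indicator hE
  have hprod : Integrable (ψ * E.indicator (fun _ => (1 : ℝ))) μ :=
    hint.bdd_mul (hψ.mono hm le_rfl).aestronglyMeasurable
      (Filter.Eventually.of_forall fun ω => by simpa using hR ω)
  have h1 := condExp_mul_of_stronglyMeasurable_left (μ := μ) hψ.stronglyMeasurable hprod hint
  have h2 := integral_condExp (μ := μ) (f := ψ * E.indicator (fun _ => (1 : ℝ))) hm
  calc ∫ ω, ψ ω * E.indicator (fun _ => (1 : ℝ)) ω ∂μ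
      = ∫ ω, (μ[ψ * E.indicator (fun _ => (1 : ℝ)) | m]) ω ∂μ := h2.symm
    _ = ∫ ω, ψ ω * p ω ∂μ := by
      refine integral_congr_ae ?_
      filter_upwards [h1, hp] with ω h h'
      rw [h, Pi.mul_apply, h']

theorem integrable_mul_coinProb {μ : Measure Ω} {m : MeasurableSpace Ω} (hm : m ≤ mΩ) {E : Set Ω}
    {p ψ : Ω → ℝ} (hp : μ[E.indicator (fun _ => (1 : ℝ)) | m] =ᵐ[μ] p)
    (hψ : Measurable[m] ψ) {R : ℝ} (hR : ∀ ω, |ψ ω| ≤ R) :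
    Integrable (fun ω => ψ ω * p ω) μ :=
  (integrable_condExp.congr hp).bdd_mul (hψ.mono hm le_rfl).aestronglyMeasurable
      (Filter.Eventually.of_forall fun ω => by simpa using hR ω)

/-- Success of a coin on an event on which its conditional probability is at most `ε`. -/
theorem measure_inter_coin_le {m : MeasurableSpace Ω} (hm : m ≤ mΩ) {E S : Set Ω}
    (hE : MeasurableSet[mΩ] E) (hS : MeasurableSet[m] S) {p : Ω → ℝ} {ε : ℝ}
    (hp : μ[E.indicator (fun _ => (1 : ℝ)) | m] =ᵐ[μ] p) (hε : 0 ≤ ε) (hle : ∀ ω ∈ S, p ω ≤ ε) :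
    μ.real (S ∩ E) ≤ ε := by
  have hψ : Measurable[m] (S.indicator (fun _ => (1 : ℝ))) := measurable_const.indicator hS
  have hR : ∀ ω, |S.indicator (fun _ => (1 : ℝ)) ω| ≤ 1 := by
    intro ω; by_cases h : ω ∈ S <;> simp [h]
  have h := integral_mul_coin hm hE hp hψ hR
  have h0 : ∫ ω, S.indicator (fun _ => (1 : ℝ)) ω * E.indicator (fun _ => (1 : ℝ)) ω ∂μ
      = μ.real (S ∩ E) := by
    rw [← integral_indicator_one ((hm _ hS).inter hE)]
    congr 1; ext ω
    by_cases h1 : ω ∈ S <;> by_cases h2 : ω ∈ E <;> simp [h1, h2]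
  rw [← h0, h]
  calc ∫ ω, S.indicator (fun _ => (1 : ℝ)) ω * p ω ∂μ ≤ ∫ _, ε ∂μ := by
        refine integral_mono (integrable_mul_coinProb hm hp hψ hR) (integrable_const _) ?_
        intro ω
        by_cases h1 : ω ∈ S
        · simpa [h1] using hle ω h1
        · simpa [h1] using hε
    _ = ε := by simp

/-- A coin whose conditional success probability is one succeeds almost surely. -/
theorem measure_inter_compl_coin {m : MeasurableSpace Ω} (hm : m ≤ mΩ) {E S : Set Ω}
    (hE : MeasurableSet[mΩ] E) (hS : MeasurableSet[m] S) {p : Ω → ℝ}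
    (hp : μ[E.indicator (fun _ => (1 : ℝ)) | m] =ᵐ[μ] p) (hone : ∀ ω ∈ S, p ω = 1) :
    μ.real (S \ E) = 0 := by
  have hψ : Measurable[m] (S.indicator (fun _ => (1 : ℝ))) := measurable_const.indicator hS
  have hR : ∀ ω, |S.indicator (fun _ => (1 : ℝ)) ω| ≤ 1 := by
    intro ω; by_cases h : ω ∈ S <;> simp [h]
  have h := integral_mul_coin hm hE hp hψ hR
  have h0 : ∫ ω, S.indicator (fun _ => (1 : ℝ)) ω * E.indicator (fun _ => (1 : ℝ)) ω ∂μ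
      = μ.real (S ∩ E) := by
    rw [← integral_indicator_one ((hm _ hS).inter hE)]
    congr 1; ext ω
    by_cases h1 : ω ∈ S <;> by_cases h2 : ω ∈ E <;> simp [h1, h2]
  have h3 : ∫ ω, S.indicator (fun _ => (1 : ℝ)) ω * p ω ∂μ = μ.real S := by
    rw [← integral_indicator_one (hm _ hS)]
    congr 1; ext ω
    by_cases h1 : ω ∈ S
    · simp [h1, hone ω h1]
    · simp [h1]
  have h4 := measureReal_inter_add_sdiff (μ := μ) (s := S) hE
  linarith [h0.symm.trans (h.trans h3)]

/-- The exponential supermartingale driven by a sequence of coins. -/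
theorem integral_exp_coins_le_one {𝓖 : Filtration ℕ mΩ} {T : ℕ} {add : ℕ → Set Ω}
    {p a c : ℕ → Ω → ℝ} {R : ℝ}
    (hadd : ∀ s < T, MeasurableSet[𝓖 (s + 1)] (add s))
    (hp : ∀ s < T, μ[(add s).indicator (fun _ => (1 : ℝ)) | 𝓖 s] =ᵐ[μ] p s)
    (ha : ∀ s < T, Measurable[𝓖 s] (a s)) (hc : ∀ s < T, Measurable[𝓖 s] (c s))
    (haR : ∀ s < T, ∀ ω, |a s ω| ≤ R) (hcR : ∀ s < T, ∀ ω, |c s ω| ≤ R)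
    (hkey : ∀ s < T, ∀ ω, (Real.exp (a s ω) - 1) * p s ω ≤ c s ω) :
    ∀ t ≤ T, (Measurable[𝓖 t] fun ω => ∑ s ∈ Finset.range t, ((add s).indicator (a s) ω - c s ω)) ∧
      (∀ ω, |∑ s ∈ Finset.range t, ((add s).indicator (a s) ω - c s ω)| ≤ t * (2 * R)) ∧
      ∫ ω, Real.exp (∑ s ∈ Finset.range t, ((add s).indicator (a s) ω - c s ω)) ∂μ ≤ 1 := by
  intro t
  induction t with
  | zero => intro _; simp
  | succ t ih =>
    intro ht
    obtain ⟨hm, hb, hi⟩ := ih (by omega)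
    have htT : t < T := by omega
    set S : Ω → ℝ := fun ω => ∑ s ∈ Finset.range t, ((add s).indicator (a s) ω - c s ω) with hS
    have hle : 𝓖 t ≤ 𝓖 (t + 1) := 𝓖.mono (Nat.le_succ t)
    simp only [Finset.sum_range_succ]
    refine ⟨?_, ?_, ?_⟩
    · exact (hm.mono hle le_rfl).add
        ((((ha t htT).mono hle le_rfl).indicator (hadd t htT)).sub ((hc t htT).mono hle le_rfl))
    · intro ω
      have h1 : |(add t).indicator (a t) ω| ≤ R := by
        by_cases h : ω ∈ add t
        · simpa [h] using haR t htT ω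
        · simpa [h] using (abs_nonneg _).trans (haR t htT ω)
      have h2 := hcR t htT ω
      have h3 := abs_add_le (∑ s ∈ Finset.range t, ((add s).indicator (a s) ω - c s ω))
        ((add t).indicator (a t) ω - c t ω)
      have h4 := abs_sub ((add t).indicator (a t) ω) (c t ω)
      have h5 := hb ω
      push_cast
      linarith
    · set φ : Ω → ℝ := fun ω => Real.exp (S ω - c t ω) with hφ
      set ψ : Ω → ℝ := fun ω => φ ω * (Real.exp (a t ω) - 1) with hψ
      have hφm : Measurable[𝓖 t] φ := Real.measurable_exp.comp (hm.sub (hc t htT))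
      have hψm : Measurable[𝓖 t] ψ :=
        hφm.mul ((Real.measurable_exp.comp (ha t htT)).sub measurable_const)
      have hφR : ∀ ω, |φ ω| ≤ Real.exp (t * (2 * R) + R) := by
        intro ω
        rw [abs_of_pos (Real.exp_pos _)]
        refine Real.exp_le_exp.2 ?_
        have := hb ω; have := hcR t htT ω
        have h1 := le_abs_self (S ω); have h2 := neg_abs_le (c t ω)
        linarith
      have hψR : ∀ ω, |ψ ω| ≤ Real.exp (t * (2 * R) + R) * (Real.exp R + 1) := by
        intro ω
        rw [hψ, abs_mul]
        refine mul_le_mul (hφR ω) ?_ (abs_nonneg _) (Real.exp_pos _).le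
        have h1 := (le_abs_self _).trans (haR t htT ω)
        have h2 := Real.exp_le_exp.2 h1
        rw [abs_le]
        have := Real.exp_pos (a t ω); have := Real.exp_pos R
        constructor <;> linarith
      -- On an indicator the exponential is affine, so the coin enters linearly and its conditional
      -- expectation may be replaced by `p t`.
      have hsplit : ∀ ω, Real.exp (S ω + ((add t).indicator (a t) ω - c t ω))
          = φ ω + ψ ω * (add t).indicator (fun _ => (1 : ℝ)) ω := by
        intro ω
        by_cases h : ω ∈ add t
        · simp only [h, Set.indicator_of_mem, hψ, hφ, mul_one]
          rw [show S ω + (a t ω - c t ω) = (S ω - c t ω) + a t ω by ring, Real.exp_add]; ring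
        · simp only [h, not_false_eq_true, Set.indicator_of_notMem, hφ, mul_zero, add_zero]
          congr 1; ring
      have hm' : 𝓖 t ≤ mΩ := 𝓖.le t
      have hEm : MeasurableSet (add t) := 𝓖.le (t + 1) _ (hadd t htT)
      have hind : Integrable ((add t).indicator (fun _ => (1 : ℝ))) μ :=
        (integrable_const 1).indicator hEm
      have hφi := integrable_of_measurable_bounded (μ := μ) hm' hφm hφR
      have hψi : Integrable (fun ω => ψ ω * (add t).indicator (fun _ => (1 : ℝ)) ω) μ :=
        hind.bdd_mul (hψm.mono hm' le_rfl).aestronglyMeasurable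
          (Filter.Eventually.of_forall fun ω => by simpa using hψR ω)
      have hψp := integrable_mul_coinProb hm' (hp t htT) hψm hψR
      have hexpm : Measurable[𝓖 t] fun ω => Real.exp (S ω) := Real.measurable_exp.comp hm
      have hSi : Integrable (fun ω => Real.exp (S ω)) μ :=
        integrable_of_measurable_bounded hm' hexpm (R := Real.exp (t * (2 * R))) (fun ω => by
          rw [abs_of_pos (Real.exp_pos _)]
          exact Real.exp_le_exp.2 ((le_abs_self _).trans (hb ω)))
      calc ∫ ω, Real.exp (S ω + ((add t).indicator (a t) ω - c t ω)) ∂μ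
          = ∫ ω, (φ ω + ψ ω * (add t).indicator (fun _ => (1 : ℝ)) ω) ∂μ := by
            simp only [hsplit]
        _ = ∫ ω, (φ ω + ψ ω * p t ω) ∂μ := by
            rw [integral_add hφi hψi, integral_mul_coin hm' hEm (hp t htT) hψm hψR,
              ← integral_add hφi hψp]
        _ ≤ ∫ ω, Real.exp (S ω) ∂μ := by
            refine integral_mono (hφi.add hψp) hSi ?_
            intro ω
            -- The conditional mean of the new factor is exp(-c)(1 + (exp(a) - 1)p) ≤ exp(-c)(1 + c)
            -- ≤ 1.
            have h1 := hkey t htT ω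
            have h2 : 1 + c t ω ≤ Real.exp (c t ω) := by linarith [Real.add_one_le_exp (c t ω)]
            have h3 : φ ω * Real.exp (c t ω) = Real.exp (S ω) := by
              rw [hφ, ← Real.exp_add]; congr 1; ring
            have h4 : 0 < φ ω := Real.exp_pos _
            calc φ ω + ψ ω * p t ω = φ ω * (1 + (Real.exp (a t ω) - 1) * p t ω) := by
                  rw [hψ]; ring
              _ ≤ φ ω * Real.exp (c t ω) := by gcongr; linarith
              _ = Real.exp (S ω) := h3
        _ ≤ 1 := hi

/-- Markov's inequality for the exponential of the compensated sum. -/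
theorem measure_coins_ge_le {𝓖 : Filtration ℕ mΩ} {T : ℕ} {add : ℕ → Set Ω}
    {p a c : ℕ → Ω → ℝ} {R : ℝ}
    (hadd : ∀ s < T, MeasurableSet[𝓖 (s + 1)] (add s))
    (hp : ∀ s < T, μ[(add s).indicator (fun _ => (1 : ℝ)) | 𝓖 s] =ᵐ[μ] p s)
    (ha : ∀ s < T, Measurable[𝓖 s] (a s)) (hc : ∀ s < T, Measurable[𝓖 s] (c s))
    (haR : ∀ s < T, ∀ ω, |a s ω| ≤ R) (hcR : ∀ s < T, ∀ ω, |c s ω| ≤ R)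
    (hkey : ∀ s < T, ∀ ω, (Real.exp (a s ω) - 1) * p s ω ≤ c s ω) {t : ℕ} (ht : t ≤ T) (l : ℝ) :
    μ.real {ω | l ≤ ∑ s ∈ Finset.range t, ((add s).indicator (a s) ω - c s ω)}
      ≤ Real.exp (-l) := by
  obtain ⟨hm, hb, hi⟩ := integral_exp_coins_le_one hadd hp ha hc haR hcR hkey t ht
  set S : Ω → ℝ := fun ω => ∑ s ∈ Finset.range t, ((add s).indicator (a s) ω - c s ω) with hS
  have hSi : Integrable (fun ω => Real.exp (S ω)) μ :=
    integrable_of_measurable_bounded (𝓖.le t) (Real.measurable_exp.comp hm)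
      (R := Real.exp (t * (2 * R))) (fun ω => by
        rw [abs_of_pos (Real.exp_pos _)]
        exact Real.exp_le_exp.2 ((le_abs_self _).trans (hb ω)))
  have h := mul_meas_ge_le_integral_of_nonneg (μ := μ)
    (Filter.Eventually.of_forall fun ω => (Real.exp_pos (S ω)).le) hSi (Real.exp l)
  have hset : {ω | Real.exp l ≤ Real.exp (S ω)} = {ω | l ≤ S ω} := by
    ext ω; simp
  rw [hset] at h
  rw [Real.exp_neg, ← one_div, le_div_iff₀ (Real.exp_pos _), mul_comm]
  exact h.trans hi

/-- Upper tail: a coin with success probability `1 / n` adds `n` copies of `x`, where `n x ≤ b`. -/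
theorem measure_copies_upper {𝓖 : Filtration ℕ mΩ} {T : ℕ} {add : ℕ → Set Ω}
    {n x : ℕ → Ω → ℝ} {b : ℝ} (hb : 0 < b)
    (hadd : ∀ s < T, MeasurableSet[𝓖 (s + 1)] (add s))
    (hp : ∀ s < T, μ[(add s).indicator (fun _ => (1 : ℝ)) | 𝓖 s] =ᵐ[μ] fun ω => 1 / n s ω)
    (hn : ∀ s < T, Measurable[𝓖 s] (n s)) (hx : ∀ s < T, Measurable[𝓖 s] (x s))
    (hx0 : ∀ s < T, ∀ ω, 0 ≤ x s ω) (hn1 : ∀ s < T, ∀ ω, x s ω = 0 ∨ 1 ≤ n s ω)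
    (hxb : ∀ s < T, ∀ ω, n s ω * x s ω ≤ b) {t : ℕ} (ht : t ≤ T) (l : ℝ) :
    μ.real {ω | 2 * ∑ s ∈ Finset.range t, x s ω + b * l ≤
      ∑ s ∈ Finset.range t, (add s).indicator (fun ω => n s ω * x s ω) ω} ≤ Real.exp (-l) := by
  have h0 : ∀ s < T, ∀ ω, 0 ≤ n s ω * x s ω := by
    intro s hs ω
    rcases hn1 s hs ω with h | h
    · simp [h]
    · exact mul_nonneg (by linarith) (hx0 s hs ω)
  have hxle : ∀ s < T, ∀ ω, x s ω ≤ n s ω * x s ω := by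
    intro s hs ω
    rcases hn1 s hs ω with h | h
    · simp [h]
    · nlinarith [hx0 s hs ω]
  -- Scaling by `b` puts y = n x / b in [0, 1], where exp(y) - 1 ≤ 2y. Multiplied by the probability
  -- `1/n`, this gives the compensator 2x/b. The alternative x = 0 covers steps with n = 0.
  have key := measure_coins_ge_le (μ := μ) (a := fun s ω => n s ω * x s ω / b)
    (c := fun s ω => 2 * x s ω / b) (R := 2) hadd hp
    (fun s hs => ((hn s hs).mul (hx s hs)).div_const b)
    (fun s hs => ((hx s hs).const_mul 2).div_const b)
    (fun s hs ω => by
      rw [abs_of_nonneg (div_nonneg (h0 s hs ω) hb.le), div_le_iff₀ hb]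
      linarith [hxb s hs ω])
    (fun s hs ω => by
      rw [abs_of_nonneg (div_nonneg (by linarith [hx0 s hs ω]) hb.le), div_le_iff₀ hb]
      linarith [hxb s hs ω, hxle s hs ω])
    (fun s hs ω => by
      rcases hn1 s hs ω with h | h
      · simp [h]
      · have hy0 : 0 ≤ n s ω * x s ω / b := div_nonneg (h0 s hs ω) hb.le
        have hy1 : n s ω * x s ω / b ≤ 1 := by
          rw [div_le_iff₀ hb]; linarith [hxb s hs ω]
        have he := Real.abs_exp_sub_one_sub_id_le (x := n s ω * x s ω / b)
          (by rw [abs_of_nonneg hy0]; exact hy1)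
        have he' := (abs_le.1 he).2
        have hnp : (0 : ℝ) < n s ω := by linarith
        have : Real.exp (n s ω * x s ω / b) - 1 ≤ 2 * (n s ω * x s ω / b) := by nlinarith
        calc (Real.exp (n s ω * x s ω / b) - 1) * (1 / n s ω)
            ≤ (2 * (n s ω * x s ω / b)) * (1 / n s ω) := by gcongr
          _ = 2 * x s ω / b := by field_simp) ht l
  refine le_trans (measureReal_mono ?_) key
  intro ω hω
  simp only [Set.mem_ofPred_eq] at hω ⊢
  have e1 : ∀ s, (add s).indicator (fun ω => n s ω * x s ω / b) ω
      = (add s).indicator (fun ω => n s ω * x s ω) ω / b := by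
    intro s
    by_cases h : ω ∈ add s <;> simp [h]
  have e2 : ∑ s ∈ Finset.range t,
      ((add s).indicator (fun ω => n s ω * x s ω / b) ω - 2 * x s ω / b)
      = (∑ s ∈ Finset.range t, (add s).indicator (fun ω => n s ω * x s ω) ω
        - 2 * ∑ s ∈ Finset.range t, x s ω) / b := by
    rw [Finset.sum_sub_distrib, Finset.mul_sum, sub_div, Finset.sum_div, Finset.sum_div]
    simp only [e1]
  rw [e2, le_div_iff₀ hb]
  linarith

/-- Lower tail: a coin with success probability `1 / n` adds `n` copies of `x`, where `n x ≤ b`. -/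
theorem measure_copies_lower {𝓖 : Filtration ℕ mΩ} {T : ℕ} {add : ℕ → Set Ω}
    {n x : ℕ → Ω → ℝ} {b : ℝ} (hb : 0 < b)
    (hadd : ∀ s < T, MeasurableSet[𝓖 (s + 1)] (add s))
    (hp : ∀ s < T, μ[(add s).indicator (fun _ => (1 : ℝ)) | 𝓖 s] =ᵐ[μ] fun ω => 1 / n s ω)
    (hn : ∀ s < T, Measurable[𝓖 s] (n s)) (hx : ∀ s < T, Measurable[𝓖 s] (x s))
    (hx0 : ∀ s < T, ∀ ω, 0 ≤ x s ω) (hn1 : ∀ s < T, ∀ ω, x s ω = 0 ∨ 1 ≤ n s ω)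
    (hxb : ∀ s < T, ∀ ω, n s ω * x s ω ≤ b) {t : ℕ} (ht : t ≤ T) (l : ℝ) :
    μ.real {ω | ∑ s ∈ Finset.range t, (add s).indicator (fun ω => n s ω * x s ω) ω ≤
      (∑ s ∈ Finset.range t, x s ω) / 2 - b * l} ≤ Real.exp (-l) := by
  have h0 : ∀ s < T, ∀ ω, 0 ≤ n s ω * x s ω := by
    intro s hs ω
    rcases hn1 s hs ω with h | h
    · simp [h]
    · exact mul_nonneg (by linarith) (hx0 s hs ω)
  have hxle : ∀ s < T, ∀ ω, x s ω ≤ n s ω * x s ω := by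
    intro s hs ω
    rcases hn1 s hs ω with h | h
    · simp [h]
    · nlinarith [hx0 s hs ω]
  -- Here the inequality used is exp(-y) ≤ 1/(1 + y) ≤ 1 - y/2 on [0, 1], which yields the
  -- compensator -x/(2b).
  have key := measure_coins_ge_le (μ := μ) (a := fun s ω => -(n s ω * x s ω / b))
    (c := fun s ω => -(x s ω / (2 * b))) (R := 1) hadd hp
    (fun s hs => (((hn s hs).mul (hx s hs)).div_const b).neg)
    (fun s hs => ((hx s hs).div_const (2 * b)).neg)
    (fun s hs ω => by
      rw [abs_neg, abs_of_nonneg (div_nonneg (h0 s hs ω) hb.le), div_le_iff₀ hb]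
      linarith [hxb s hs ω])
    (fun s hs ω => by
      rw [abs_neg, abs_of_nonneg (div_nonneg (hx0 s hs ω) (by linarith)),
        div_le_iff₀ (by linarith)]
      linarith [hxb s hs ω, hxle s hs ω])
    (fun s hs ω => by
      rcases hn1 s hs ω with h | h
      · simp [h]
      · have hy0 : 0 ≤ n s ω * x s ω / b := div_nonneg (h0 s hs ω) hb.le
        have hy1 : n s ω * x s ω / b ≤ 1 := by
          rw [div_le_iff₀ hb]; linarith [hxb s hs ω]
        have hnp : (0 : ℝ) < n s ω := by linarith
        have hexp : Real.exp (-(n s ω * x s ω / b)) - 1 ≤ -((n s ω * x s ω / b) / 2) := by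
          set y := n s ω * x s ω / b
          have h1 : 1 + y ≤ Real.exp y := by linarith [Real.add_one_le_exp y]
          rw [Real.exp_neg, sub_le_iff_le_add, inv_le_comm₀ (Real.exp_pos _) (by linarith)]
          refine le_trans ?_ h1
          rw [inv_le_iff_one_le_mul₀ (by linarith)]
          nlinarith
        calc (Real.exp (-(n s ω * x s ω / b)) - 1) * (1 / n s ω)
            ≤ (-((n s ω * x s ω / b) / 2)) * (1 / n s ω) := by gcongr
          _ = -(x s ω / (2 * b)) := by field_simp) ht l
  refine le_trans (measureReal_mono ?_) key
  intro ω hω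
  simp only [Set.mem_ofPred_eq] at hω ⊢
  have e1 : ∀ s, (add s).indicator (fun ω => -(n s ω * x s ω / b)) ω
      = -((add s).indicator (fun ω => n s ω * x s ω) ω / b) := by
    intro s
    by_cases h : ω ∈ add s <;> simp [h]
  have e2 : ∑ s ∈ Finset.range t,
      ((add s).indicator (fun ω => -(n s ω * x s ω / b)) ω - -(x s ω / (2 * b)))
      = ((∑ s ∈ Finset.range t, x s ω) / 2
        - ∑ s ∈ Finset.range t, (add s).indicator (fun ω => n s ω * x s ω) ω) / b := by
    rw [Finset.sum_sub_distrib, sub_div, div_div, Finset.sum_div, Finset.sum_div]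
    simp only [e1, Finset.sum_neg_distrib]
    ring
  rw [e2, le_div_iff₀ hb]
  linarith

end Concentration

/-! ### Sums over the sub-sample, and weight rounding -/

section Subsample

variable {Z : Type*}

/-- The number of copies that the sub-sampling adds at step `t` if the coin says so. -/
noncomputable def stepCopies (P : Params) (F : Finset (Z → ℝ)) (full : Bool)
    (w : ℕ → Z × ℝ) (add : ℕ → Prop) (t : ℕ) : ℕ :=
  copies (stepProb P F full w t (subsample P F full w add t))

open Classical in
theorem sum_map_subsample (P : Params) (F : Finset (Z → ℝ)) (full : Bool)
    (w : ℕ → Z × ℝ) (add : ℕ → Prop) (φ : Z × ℝ → ℝ) (t : ℕ) :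
    ((subsample P F full w add t).map φ).sum =
      ∑ s ∈ Finset.range t,
        if add s then (stepCopies P F full w add s : ℝ) * φ (w s) else 0 := by
  induction t with
  | zero => simp [subsample]
  | succ t ih =>
    rw [Finset.sum_range_succ, ← ih, subsample]
    split_ifs with h
    · simp [stepCopies]
    · simp

theorem wnormSq_prefixData (w : ℕ → Z × ℝ) (t : ℕ) (g : Z → ℝ) :
    wnormSq (prefixData w t) g = ∑ s ∈ Finset.range t, g (w s).1 ^ 2 / (w s).2 ^ 2 := by
  simp [wnormSq, prefixData, Finset.sum]

theorem wnormSq_nonneg (D : WData Z) (g : Z → ℝ) : 0 ≤ wnormSq D g :=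
  Multiset.sum_nonneg (by
    intro x hx
    obtain ⟨p, -, rfl⟩ := Multiset.mem_map.1 hx
    positivity)

theorem roundedWeight_nonneg (κ σ : ℝ) : 0 ≤ roundedWeight κ σ := by
  unfold roundedWeight; split_ifs <;> positivity

theorem roundedWeight_le (κ : ℝ) {σ : ℝ} (hσ : 0 < σ) : roundedWeight κ σ ≤ 1 / σ ^ 2 := by
  unfold roundedWeight
  split_ifs
  · positivity
  · exact_mod_cast Int.zpow_log_le_self (b := 2) (by norm_num) (by positivity : 0 < 1 / σ ^ 2)

theorem le_two_mul_roundedWeight {κ σ : ℝ} (h : κ ≤ 1 / σ ^ 2) :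
    1 / σ ^ 2 ≤ 2 * roundedWeight κ σ := by
  unfold roundedWeight
  rw [if_neg (not_lt.2 h)]
  have := (Int.lt_zpow_succ_log_self (b := 2) (by norm_num) (1 / σ ^ 2)).le
  rw [zpow_add₀ (by norm_num)] at this
  push_cast at this
  linarith

theorem roundedNormSq_nonneg (κ : ℝ) (D : WData Z) (g : Z → ℝ) : 0 ≤ roundedNormSq κ D g :=
  Multiset.sum_nonneg (by
    intro x hx
    obtain ⟨p, -, rfl⟩ := Multiset.mem_map.1 hx
    exact mul_nonneg (roundedWeight_nonneg _ _) (sq_nonneg _))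

theorem subsample_le_of_le (P : Params) (F : Finset (Z → ℝ)) (full : Bool)
    (w : ℕ → Z × ℝ) (add : ℕ → Prop) {t t' : ℕ} (h : t ≤ t') :
    subsample P F full w add t ≤ subsample P F full w add t' := by
  classical
  induction t', h using Nat.le_induction with
  | base => exact le_rfl
  | succ t' _ ih =>
    refine ih.trans ?_
    rw [subsample]
    split_ifs
    · exact Multiset.le_add_right _ _
    · exact le_rfl

theorem roundedNormSq_mono (κ : ℝ) {D D' : WData Z} (h : D ≤ D') (g : Z → ℝ) :
    roundedNormSq κ D g ≤ roundedNormSq κ D' g := by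
  obtain ⟨E, rfl⟩ := Multiset.le_iff_exists_add.1 h
  have : roundedNormSq κ (D + E) g = roundedNormSq κ D g + roundedNormSq κ E g := by
    simp [roundedNormSq]
  linarith [roundedNormSq_nonneg κ E g]

end Subsample

/-! ### Predictability of the sub-sampling -/

section Measurability

variable {Ω Z : Type*}

theorem measurable_comp_of_levelSets [Finite Z] {m : MeasurableSpace Ω} {z : Ω → Z}
    (hz : ∀ z₀, MeasurableSet[m] {ω | z ω = z₀}) (g : Z → ℝ) :
    Measurable[m] fun ω => g (z ω) := by
  let _ : MeasurableSpace Z := ⊤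
  have h : Measurable z := measurable_to_countable' fun z₀ => hz z₀
  exact measurable_from_top.comp h

theorem measurable_targetProb [Finite Z] {m : MeasurableSpace Ω} (P : Params)
    (F : Finset (Z → ℝ)) {R : Ω → WData Z} {z : Ω → Z} {σ : Ω → ℝ}
    (hR : ∀ g, Measurable[m] fun ω => wnormSq (R ω) g)
    (hz : ∀ z₀, MeasurableSet[m] {ω | z ω = z₀}) (hσ : Measurable[m] σ) :
    Measurable[m] fun ω => targetProb P F (R ω) (z ω) (σ ω) := by
  have hs : Measurable[m] fun ω => sensitivity P F (R ω) (z ω) (σ ω) := by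
    unfold sensitivity
    refine Measurable.min ?_ measurable_const
    refine Measurable.iSup fun f => ?_
    have h1 := measurable_comp_of_levelSets hz (f.1.1 - f.2.1)
    have h2 := hR (f.1.1 - f.2.1)
    simp only [Pi.sub_apply] at h1
    fun_prop
  unfold targetProb
  fun_prop

/-- No σ-algebra on multisets is needed: the sub-sample influences the next probability only through
its norms, and these are updated by an explicit measurable recursion. Norms and numbers of copies
are therefore treated together, by induction on time. -/
theorem measurable_subsample [Finite Z] {mΩ : MeasurableSpace Ω} {𝓖 : Filtration ℕ mΩ} {T : ℕ}
    {z : ℕ → Ω → Z} {σ : ℕ → Ω → ℝ} {add : ℕ → Set Ω}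
    (hz : ∀ t < T, ∀ z₀, MeasurableSet[𝓖 t] {ω | z t ω = z₀})
    (hσ : ∀ t < T, Measurable[𝓖 t] (σ t))
    (hadd : ∀ t < T, MeasurableSet[𝓖 (t + 1)] (add t))
    (P : Params) (F : Finset (Z → ℝ)) (full : Bool) :
    ∀ t < T, (∀ g, Measurable[𝓖 t] fun ω => wnormSq
        (subsample P F full (fun t => (z t ω, σ t ω)) (fun s => ω ∈ add s) t) g) ∧
      Measurable[𝓖 t] fun ω =>
        stepCopies P F full (fun t => (z t ω, σ t ω)) (fun s => ω ∈ add s) t := by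
  classical
  have hcop : ∀ t < T, (∀ g, Measurable[𝓖 t] fun ω => wnormSq
        (subsample P F full (fun t => (z t ω, σ t ω)) (fun s => ω ∈ add s) t) g) →
      Measurable[𝓖 t] fun ω =>
        stepCopies P F full (fun t => (z t ω, σ t ω)) (fun s => ω ∈ add s) t := by
    intro t ht h
    have hR : ∀ g, Measurable[𝓖 t] fun ω => wnormSq (refData full
        (prefixData (fun t => (z t ω, σ t ω)) t)
        (subsample P F full (fun t => (z t ω, σ t ω)) (fun s => ω ∈ add s) t)) g := by
      intro g
      cases full with
      | false => simpa [refData] using h g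
      | true =>
        simp only [refData, if_true, wnormSq_prefixData]
        refine Finset.measurable_fun_sum _ fun s hs => ?_
        have hst : s < t := Finset.mem_range.1 hs
        have h1 := measurable_comp_of_levelSets (hz s (hst.trans ht)) g
        exact ((h1.pow_const 2).div ((hσ s (hst.trans ht)).pow_const 2)).mono
          (𝓖.mono hst.le) le_rfl
    have := measurable_targetProb P F hR (hz t ht) (hσ t ht)
    exact Nat.measurable_floor.comp (measurable_const.div this)
  intro t
  induction t with
  | zero =>
    intro ht
    have h0 : ∀ g, Measurable[𝓖 0] fun ω => wnormSq
        (subsample P F full (fun t => (z t ω, σ t ω)) (fun s => ω ∈ add s) 0) g := by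
      intro g; simp [subsample, wnormSq]
    exact ⟨h0, hcop 0 ht h0⟩
  | succ t ih =>
    intro ht
    obtain ⟨h1, h2⟩ := ih (by omega)
    have hle : 𝓖 t ≤ 𝓖 (t + 1) := 𝓖.mono (Nat.le_succ t)
    have h3 : ∀ g, Measurable[𝓖 (t + 1)] fun ω => wnormSq
        (subsample P F full (fun t => (z t ω, σ t ω)) (fun s => ω ∈ add s) (t + 1)) g := by
      intro g
      have hrec : ∀ ω, wnormSq
          (subsample P F full (fun t => (z t ω, σ t ω)) (fun s => ω ∈ add s) (t + 1)) g
          = wnormSq (subsample P F full (fun t => (z t ω, σ t ω)) (fun s => ω ∈ add s) t) g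
            + (add t).indicator (fun ω =>
              (stepCopies P F full (fun t => (z t ω, σ t ω)) (fun s => ω ∈ add s) t : ℝ) *
                (g (z t ω) ^ 2 / σ t ω ^ 2)) ω := by
        intro ω
        unfold wnormSq
        rw [sum_map_subsample, sum_map_subsample, Finset.sum_range_succ]
        by_cases h : ω ∈ add t <;> simp [h]
      simp only [hrec]
      have hg := measurable_comp_of_levelSets (hz t (by omega)) g
      have h4 : Measurable[𝓖 t] fun ω =>
          (stepCopies P F full (fun t => (z t ω, σ t ω)) (fun s => ω ∈ add s) t : ℝ) *
                (g (z t ω) ^ 2 / σ t ω ^ 2) :=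
        (measurable_from_top.comp h2).mul
          ((hg.pow_const 2).div ((hσ t (by omega)).pow_const 2))
      exact ((h1 g).mono hle le_rfl).add ((h4.mono hle le_rfl).indicator (hadd t (by omega)))
    exact ⟨h3, hcop (t + 1) ht h3⟩

end Measurability

theorem copies_eq_zero {q : ℝ} (h0 : 0 ≤ q) (h1 : q ≤ 1) (h : copies q = 0) : q = 0 := by
  by_contra hne
  have hq : 0 < q := lt_of_le_of_ne h0 (Ne.symm hne)
  have := Nat.floor_eq_zero.1 h
  rw [div_lt_one hq] at this
  linarith

theorem copies_mul_le_one {q : ℝ} (h0 : 0 ≤ q) : copies q * q ≤ 1 := by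
  rcases h0.eq_or_lt with rfl | hq
  · simp
  · have := Nat.floor_le (one_div_pos.2 hq).le
    rwa [le_div_iff₀ hq] at this

/-- Rounding 1/q ≥ 1 down to an integer loses at most a factor two. -/
theorem one_div_copies_le {q : ℝ} (h0 : 0 ≤ q) (h1 : q ≤ 1) : 1 / (copies q : ℝ) ≤ 2 * q := by
  rcases h0.eq_or_lt with rfl | hq
  · simp [copies]
  · have h2 : (1 : ℝ) ≤ 1 / q := by rw [le_div_iff₀ hq]; linarith
    have h3 : 1 ≤ copies q := Nat.le_floor (by exact_mod_cast h2)
    have h4 : (1 : ℝ) ≤ copies q := by exact_mod_cast h3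
    have h5 : 1 / q < copies q + 1 := Nat.lt_floor_add_one _
    rw [div_lt_iff₀ hq] at h5
    rw [div_le_iff₀ (by linarith)]
    nlinarith

/-! ### What the sampling probability guarantees for one observation -/

section Sensitivity

variable {Z : Type*} {P : Params} {F : Finset (Z → ℝ)}

theorem sensitivity_nonneg (D : WData Z) (z : Z) (σ : ℝ) : 0 ≤ sensitivity P F D z σ := by
  refine le_min (Real.iSup_nonneg fun f => ?_) zero_le_one
  have := wnormSq_nonneg D (f.1.1 - f.2.1)
  positivity

theorem targetProb_nonneg (hC : 0 ≤ P.C) (hlog : 0 ≤ Real.log (P.T * P.N / P.δ))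
    (D : WData Z) (z : Z) (σ : ℝ) : 0 ≤ targetProb P F D z σ :=
  le_min zero_le_one (mul_nonneg (mul_nonneg hC (sensitivity_nonneg D z σ)) hlog)

theorem targetProb_le_one (D : WData Z) (z : Z) (σ : ℝ) : targetProb P F D z σ ≤ 1 :=
  min_le_left _ _

theorem min_le_sensitivity {f f' : Z → ℝ} (hf : f ∈ F) (hf' : f' ∈ F) (D : WData Z) (z : Z)
    (σ : ℝ) :
    min (1 / σ ^ 2 * (f z - f' z) ^ 2 /
      (min (wnormSq D (f - f')) (P.T * (P.H + 1) ^ 2 / P.α ^ 2) + P.β ^ 2)) 1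
      ≤ sensitivity P F D z σ := by
  refine min_le_min ?_ le_rfl
  exact le_ciSup (f := fun f : F × F => 1 / σ ^ 2 * (f.1.1 z - f.2.1 z) ^ 2 /
      (min (wnormSq D (f.1.1 - f.2.1)) (P.T * (P.H + 1) ^ 2 / P.α ^ 2) + P.β ^ 2))
    (Set.finite_range _).bddAbove (⟨⟨f, hf⟩, ⟨f', hf'⟩⟩ : F × F)

/-- Zero copies force zero sensitivity, hence zero contribution to the squared distance of each
pair: a point that can never be added costs nothing. -/
theorem sq_div_eq_zero_of_copies_eq_zero (hC : 1 ≤ P.C)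
    (hlog : 1 ≤ Real.log (P.T * P.N / P.δ)) (hβ : 0 < P.β ^ 2)
    {f f' : Z → ℝ} (hf : f ∈ F) (hf' : f' ∈ F) {D : WData Z} {z : Z} {σ : ℝ}
    (hn : copies (targetProb P F D z σ) = 0) : (f z - f' z) ^ 2 / σ ^ 2 = 0 := by
  have h := copies_eq_zero (targetProb_nonneg (by linarith) (by linarith) D z σ)
    (targetProb_le_one D z σ) hn
  have hs := sensitivity_nonneg (P := P) (F := F) D z σ
  have hs0 : sensitivity P F D z σ = 0 := by
    unfold targetProb at h
    rcases min_choice 1 (P.C * sensitivity P F D z σ * Real.log (P.T * P.N / P.δ)) with h' | h'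
    · rw [h'] at h; norm_num at h
    · rw [h'] at h
      by_contra hne
      have : 0 < sensitivity P F D z σ := lt_of_le_of_ne hs (Ne.symm hne)
      have : 0 < P.C * sensitivity P F D z σ * Real.log (P.T * P.N / P.δ) := by positivity
      linarith
  have hm := min_le_sensitivity (P := P) hf hf' D z σ
  rw [hs0] at hm
  have hw := wnormSq_nonneg D (f - f')
  have hden : 0 < min (wnormSq D (f - f')) (P.T * (P.H + 1) ^ 2 / P.α ^ 2) + P.β ^ 2 := by
    positivity
  rcases min_le_iff.1 hm with h1 | h1
  · rw [div_le_iff₀ hden, zero_mul] at h1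
    rw [div_eq_mul_one_div, mul_comm]
    exact le_antisymm h1 (by positivity)
  · norm_num at h1

/-- At least two copies mean a target probability q ≤ 1/2, so neither cap at one is active and q is
exactly C · sens · log. The observation is at most sens · (norm + β²), and the number of copies
times q is at most one. -/
theorem copies_mul_sq_div_le (hC : 1 ≤ P.C)
    (hlog : 1 ≤ Real.log (P.T * P.N / P.δ)) (hβ : 0 < P.β ^ 2)
    {f f' : Z → ℝ} (hf : f ∈ F) (hf' : f' ∈ F) {D : WData Z} {z : Z} {σ : ℝ}
    (hn : 2 ≤ copies (targetProb P F D z σ)) :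
    copies (targetProb P F D z σ) * ((f z - f' z) ^ 2 / σ ^ 2) ≤
      (wnormSq D (f - f') + P.β ^ 2) / (P.C * Real.log (P.T * P.N / P.δ)) := by
  set q := targetProb P F D z σ with hq
  set l := Real.log (P.T * P.N / P.δ) with hl
  have hq0 : 0 ≤ q := targetProb_nonneg (by linarith) (by linarith) D z σ
  have hn1 := copies_mul_le_one hq0
  have hn2 : (2 : ℝ) ≤ copies q := by exact_mod_cast hn
  have hq2 : q ≤ 1 / 2 := by nlinarith
  have hCl : 1 ≤ P.C * l := by nlinarith
  have hqe : q = P.C * l * sensitivity P F D z σ := by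
    rw [hq]; unfold targetProb
    rw [min_eq_right]
    · ring
    · by_contra hlt
      have : q = 1 := by rw [hq]; unfold targetProb; exact min_eq_left (not_le.1 hlt).le
      linarith
  have hs0 := sensitivity_nonneg (P := P) (F := F) D z σ
  have hs : sensitivity P F D z σ < 1 := by nlinarith
  have hm := min_le_sensitivity (P := P) hf hf' D z σ
  have hw := wnormSq_nonneg D (f - f')
  set M := min (wnormSq D (f - f')) (P.T * (P.H + 1) ^ 2 / P.α ^ 2) with hM
  have hden : 0 < M + P.β ^ 2 := by positivity
  have hMle : M ≤ wnormSq D (f - f') := min_le_left _ _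
  rcases min_le_iff.1 hm with h1 | h1
  · rw [div_le_iff₀ hden] at h1
    have hu : (f z - f' z) ^ 2 / σ ^ 2 ≤
        sensitivity P F D z σ * (wnormSq D (f - f') + P.β ^ 2) := by
      calc (f z - f' z) ^ 2 / σ ^ 2 = 1 / σ ^ 2 * (f z - f' z) ^ 2 := by ring
        _ ≤ _ := h1
        _ ≤ _ := by gcongr
    rw [le_div_iff₀ (by linarith)]
    calc copies q * ((f z - f' z) ^ 2 / σ ^ 2) * (P.C * l)
        ≤ copies q * (sensitivity P F D z σ * (wnormSq D (f - f') + P.β ^ 2)) * (P.C * l) := by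
          gcongr
      _ = (copies q * q) * (wnormSq D (f - f') + P.β ^ 2) := by rw [hqe]; ring
      _ ≤ 1 * (wnormSq D (f - f') + P.β ^ 2) := by gcongr
      _ = _ := one_mul _
  · linarith

end Sensitivity

/-! ### Deterministic consequences of a good path -/

section GoodPath

variable {Z : Type*}

/-- The value `u s`, kept only at the steps at which the coin is not trivial and the copies of
`v s` weigh at most `b` together. -/
noncomputable def truncated (P : Params) (F : Finset (Z → ℝ)) (full : Bool) (w : ℕ → Z × ℝ)
    (add : ℕ → Prop) (b : ℝ) (v u : ℕ → ℝ) (s : ℕ) : ℝ :=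
  if 2 ≤ stepCopies P F full w add s ∧ stepCopies P F full w add s * v s ≤ b then u s else 0

/-- The bound on single increments at the scale `2 ^ i`. -/
noncomputable def incrementBound (P : Params) (i : ℕ) : ℝ :=
  5 * (2 ^ i * P.β ^ 2) / (P.C * Real.log (P.T * P.N / P.δ))

/-- The weighted square of `g` at the observation `w s`. -/
noncomputable def obsSq (w : ℕ → Z × ℝ) (g : Z → ℝ) (s : ℕ) : ℝ := g (w s).1 ^ 2 / (w s).2 ^ 2

/-- The square of `g` at the observation `w s` with rounded weight. -/
noncomputable def obsRoundedSq (κ : ℝ) (w : ℕ → Z × ℝ) (g : Z → ℝ) (s : ℕ) : ℝ :=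
  roundedWeight κ (w s).2 * g (w s).1 ^ 2

open Classical in
/-- The sum of the values `x s` over the sub-sample of the first `t` observations. -/
noncomputable def sampledSum (P : Params) (F : Finset (Z → ℝ)) (full : Bool) (w : ℕ → Z × ℝ)
    (add : ℕ → Prop) (x : ℕ → ℝ) (t : ℕ) : ℝ :=
  ∑ s ∈ Finset.range t, if add s then (stepCopies P F full w add s : ℝ) * x s else 0

/-- The event on which the sub-sample is a good approximation of the data. -/
structure IsGoodPath (P : Params) (F : Finset (Z → ℝ)) (full : Bool) (κ : ℝ) (I nmax : ℕ) (l : ℝ)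
    (w : ℕ → Z × ℝ) (add : ℕ → Prop) : Prop where
  upper : ∀ f ∈ F, ∀ f' ∈ F, ∀ i < I, ∀ t < P.T,
    sampledSum P F full w add (truncated P F full w add (incrementBound P i)
      (obsSq w (f - f')) (obsSq w (f - f'))) t ≤
    2 * ∑ s ∈ Finset.range t, truncated P F full w add (incrementBound P i)
      (obsSq w (f - f')) (obsSq w (f - f')) s + 2 ^ i * P.β ^ 2 / 16
  lower : ∀ f ∈ F, ∀ f' ∈ F, ∀ i < I, ∀ t < P.T,
    (∑ s ∈ Finset.range t, truncated P F full w add (incrementBound P i)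
      (obsSq w (f - f')) (obsRoundedSq κ w (f - f')) s) / 2 - 2 ^ i * P.β ^ 2 / 16 ≤
    sampledSum P F full w add (truncated P F full w add (incrementBound P i)
      (obsSq w (f - f')) (obsRoundedSq κ w (f - f'))) t
  forced : ∀ s < P.T, stepCopies P F full w add s = 1 → add s
  count : sampledSum P F full w add (fun s => 1 / (stepCopies P F full w add s : ℝ)) P.T ≤
    2 * ∑ s ∈ Finset.range P.T, 1 / (stepCopies P F full w add s : ℝ) + l
  cap : ∀ s < P.T, add s → stepCopies P F full w add s ≤ nmax

variable {P : Params} {F : Finset (Z → ℝ)} {full : Bool} {κ L lam l : ℝ} {I nmax : ℕ}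
  {w : ℕ → Z × ℝ} {add : ℕ → Prop}

theorem wnormSq_subsample (g : Z → ℝ) (t : ℕ) :
    wnormSq (subsample P F full w add t) g = sampledSum P F full w add (obsSq w g) t := by
  unfold wnormSq sampledSum
  rw [sum_map_subsample]
  rfl

theorem roundedNormSq_subsample (g : Z → ℝ) (t : ℕ) :
    roundedNormSq κ (subsample P F full w add t) g
      = sampledSum P F full w add (obsRoundedSq κ w g) t := by
  unfold roundedNormSq sampledSum
  rw [sum_map_subsample]
  rfl

theorem obsSq_nonneg (g : Z → ℝ) (s : ℕ) : 0 ≤ obsSq w g s := by unfold obsSq; positivity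

theorem obsRoundedSq_nonneg (g : Z → ℝ) (s : ℕ) : 0 ≤ obsRoundedSq κ w g s :=
  mul_nonneg (roundedWeight_nonneg _ _) (sq_nonneg _)

theorem obsRoundedSq_le (g : Z → ℝ) {s : ℕ} (hσ : 0 < (w s).2) :
    obsRoundedSq κ w g s ≤ obsSq w g s := by
  unfold obsRoundedSq obsSq
  rw [div_eq_mul_one_div, mul_comm]
  exact mul_le_mul_of_nonneg_left (roundedWeight_le κ hσ) (sq_nonneg _)

theorem wnormSq_prefix_eq_sum (g : Z → ℝ) (t : ℕ) :
    wnormSq (prefixData w t) g = ∑ s ∈ Finset.range t, obsSq w g s := wnormSq_prefixData w t g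

theorem wnormSq_prefix_mono (g : Z → ℝ) {s t : ℕ} (h : s ≤ t) :
    wnormSq (prefixData w s) g ≤ wnormSq (prefixData w t) g := by
  rw [wnormSq_prefix_eq_sum, wnormSq_prefix_eq_sum]
  exact Finset.sum_le_sum_of_subset_of_nonneg (Finset.range_mono h)
    fun i _ _ => obsSq_nonneg g i

theorem sq_sub_le (hF : ∀ f ∈ F, ∀ z, 0 ≤ f z ∧ f z ≤ L) {f f' : Z → ℝ} (hf : f ∈ F)
    (hf' : f' ∈ F) (z : Z) : (f - f') z ^ 2 ≤ L ^ 2 := by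
  have h1 := hF f hf z
  have h2 := hF f' hf' z
  rw [Pi.sub_apply]
  exact sq_le_sq' (by linarith) (by linarith)

theorem wnormSq_prefix_le (hF : ∀ f ∈ F, ∀ z, 0 ≤ f z ∧ f z ≤ L) (hα : 0 < P.α)
    (hσ : ∀ s < P.T, P.α ≤ (w s).2) {f f' : Z → ℝ} (hf : f ∈ F) (hf' : f' ∈ F)
    {t : ℕ} (ht : t ≤ P.T) :
    wnormSq (prefixData w t) (f - f') ≤ P.T * L ^ 2 / P.α ^ 2 := by
  rw [wnormSq_prefix_eq_sum]
  calc ∑ s ∈ Finset.range t, obsSq w (f - f') s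
      ≤ ∑ s ∈ Finset.range t, L ^ 2 / P.α ^ 2 := by
        refine Finset.sum_le_sum fun s hs => ?_
        have h1 := hσ s ((Finset.mem_range.1 hs).trans_le ht)
        unfold obsSq
        have h2 := sq_sub_le hF hf hf' (w s).1
        gcongr
    _ = t * (L ^ 2 / P.α ^ 2) := by simp
    _ ≤ P.T * (L ^ 2 / P.α ^ 2) := by gcongr
    _ = _ := by ring

/-- Rounding costs a factor two, and each dropped weight contributes at most L²κ = λ/T, so at most λ
in total. -/
theorem wnormSq_prefix_le_rounded (hF : ∀ f ∈ F, ∀ z, 0 ≤ f z ∧ f z ≤ L) (hL : 0 < L)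
    (hT : 1 ≤ P.T) (hlam : 0 < lam) (hκ : κ = lam / (P.T * L ^ 2))
    {f f' : Z → ℝ} (hf : f ∈ F) (hf' : f' ∈ F) {t : ℕ} (ht : t ≤ P.T) :
    wnormSq (prefixData w t) (f - f') ≤
      2 * ∑ s ∈ Finset.range t, obsRoundedSq κ w (f - f') s + lam := by
  rw [wnormSq_prefix_eq_sum]
  have hT' : (1 : ℝ) ≤ P.T := by exact_mod_cast hT
  have hterm : ∀ s, obsSq w (f - f') s ≤ 2 * obsRoundedSq κ w (f - f') s + lam / P.T := by
    intro s
    have h2 := sq_sub_le hF hf hf' (w s).1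
    have h0 := obsRoundedSq_nonneg (κ := κ) (w := w) (f - f') s
    have hlT : 0 < lam / P.T := by positivity
    unfold obsSq at *
    rw [div_eq_mul_one_div]
    by_cases h : κ ≤ 1 / (w s).2 ^ 2
    · have := le_two_mul_roundedWeight h
      have h3 := mul_le_mul_of_nonneg_left this (sq_nonneg ((f - f') (w s).1))
      unfold obsRoundedSq at *
      linarith
    · have h4 : (f - f') (w s).1 ^ 2 * (1 / (w s).2 ^ 2) ≤ L ^ 2 * κ := by
        have := (not_le.1 h).le
        gcongr
      have h5 : L ^ 2 * κ = lam / P.T := by rw [hκ]; field_simp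
      linarith
  calc ∑ s ∈ Finset.range t, obsSq w (f - f') s
      ≤ ∑ s ∈ Finset.range t, (2 * obsRoundedSq κ w (f - f') s + lam / P.T) :=
        Finset.sum_le_sum fun s _ => hterm s
    _ = 2 * ∑ s ∈ Finset.range t, obsRoundedSq κ w (f - f') s + t * (lam / P.T) := by
        rw [Finset.sum_add_distrib, Finset.mul_sum]; simp
    _ ≤ 2 * ∑ s ∈ Finset.range t, obsRoundedSq κ w (f - f') s + P.T * (lam / P.T) := by
        gcongr
    _ = _ := by rw [mul_div_cancel₀ _ (by positivity)]

/-- Increment levels must be deterministic, whereas the norm of the data is random. A dyadic level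
comparable with norm + β² always exists among the first `I`, because the norm is at most T L²/α² and
β² ≥ λ. -/
theorem exists_scale (hF : ∀ f ∈ F, ∀ z, 0 ≤ f z ∧ f z ≤ L) (hα : 0 < P.α)
    (hσ : ∀ s < P.T, P.α ≤ (w s).2) (hlam : 0 < lam) (hβ : lam ≤ P.β ^ 2)
    (hI : 2 * (1 + P.T * L ^ 2 / P.α ^ 2 / lam) < 2 ^ I)
    {f f' : Z → ℝ} (hf : f ∈ F) (hf' : f' ∈ F) {t : ℕ} (ht : t ≤ P.T) :
    ∃ i < I, wnormSq (prefixData w t) (f - f') + P.β ^ 2 ≤ 2 ^ i * P.β ^ 2 ∧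
      2 ^ i * P.β ^ 2 ≤ 2 * (wnormSq (prefixData w t) (f - f') + P.β ^ 2) := by
  set N := wnormSq (prefixData w t) (f - f') with hN
  have hN0 : 0 ≤ N := wnormSq_nonneg _ _
  have hN1 : N ≤ P.T * L ^ 2 / P.α ^ 2 := wnormSq_prefix_le hF hα hσ hf hf' ht
  have hβ0 : 0 < P.β ^ 2 := by linarith
  obtain ⟨i, h1, h2⟩ := exists_nat_pow_near (x := N / P.β ^ 2 + 1) (y := (2 : ℝ))
    (by have : 0 ≤ N / P.β ^ 2 := by positivity
        linarith) (by norm_num)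
  have hx : (N / P.β ^ 2 + 1) * P.β ^ 2 = N + P.β ^ 2 := by
    rw [add_mul, div_mul_cancel₀ _ hβ0.ne', one_mul]
  refine ⟨i + 1, ?_, ?_, ?_⟩
  · have h3 : N / P.β ^ 2 ≤ P.T * L ^ 2 / P.α ^ 2 / lam := by gcongr
    have h4 : (2 : ℝ) ^ (i + 1) < 2 ^ I := by
      rw [pow_succ]; linarith
    exact (pow_lt_pow_iff_right₀ (by norm_num)).1 h4
  · rw [← hx]; gcongr
  · rw [← hx, pow_succ]
    have := mul_le_mul_of_nonneg_right h1 hβ0.le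
    linarith

theorem truncated_nonneg {b : ℝ} {v u : ℕ → ℝ} (hu : ∀ s, 0 ≤ u s) (s : ℕ) :
    0 ≤ truncated P F full w add b v u s := by
  unfold truncated; split_ifs
  · exact hu s
  · exact le_rfl

theorem truncated_le {b : ℝ} {v u : ℕ → ℝ} (hu : ∀ s, 0 ≤ u s) (s : ℕ) :
    truncated P F full w add b v u s ≤ u s := by
  unfold truncated; split_ifs
  · exact le_rfl
  · exact hu s

/-- This shows that truncation is inactive once the sub-sample is controlled at time `s`. The 5 in
`incrementBound` is the 4 from that control plus 1 for the β² in the sensitivity denominator. -/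
theorem stepCopies_mul_obsSq_le (hβ : 0 < P.β ^ 2) (hC : 1 ≤ P.C)
    (hlog : 1 ≤ Real.log (P.T * P.N / P.δ)) {f f' : Z → ℝ} (hf : f ∈ F) (hf' : f' ∈ F) {s : ℕ}
    (hs : wnormSq (subsample P F full w add s) (f - f')
      ≤ 4 * (wnormSq (prefixData w s) (f - f') + P.β ^ 2))
    (hn : 2 ≤ stepCopies P F full w add s) {i : ℕ}
    (hi : wnormSq (prefixData w s) (f - f') + P.β ^ 2 ≤ 2 ^ i * P.β ^ 2) :
    stepCopies P F full w add s * obsSq w (f - f') s ≤ incrementBound P i := by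
  have h := copies_mul_sq_div_le hC hlog hβ hf hf' hn
  refine h.trans ?_
  have hN0 := wnormSq_nonneg (prefixData w s) (f - f')
  have hR : wnormSq (refData full (prefixData w s) (subsample P F full w add s)) (f - f')
      ≤ 4 * (wnormSq (prefixData w s) (f - f') + P.β ^ 2) := by
    cases full with
    | false => simpa [refData] using hs
    | true => simp only [refData, if_true]; linarith
  unfold incrementBound
  have hCl : 0 < P.C * Real.log (P.T * P.N / P.δ) := by positivity
  gcongr
  linarith

theorem truncated_of_two_le {b : ℝ} {v u : ℕ → ℝ} {s : ℕ}
    (hv : 2 ≤ stepCopies P F full w add s → stepCopies P F full w add s * v s ≤ b)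
    (h2 : 2 ≤ stepCopies P F full w add s) : truncated P F full w add b v u s = u s :=
  if_pos ⟨h2, hv h2⟩

theorem truncated_of_lt_two {b : ℝ} {v u : ℕ → ℝ} {s : ℕ}
    (h2 : stepCopies P F full w add s < 2) : truncated P F full w add b v u s = 0 :=
  if_neg fun h => by omega

/-- By strong induction, control at all earlier times makes the truncation at the scale of time `t`
inactive, so the concentration bound applies to the true increments. It leaves at most 2N + (N +
β²)/8, well within the claimed bound. -/
theorem wnormSq_subsample_le (hg : IsGoodPath P F full κ I nmax l w add)
    (hF : ∀ f ∈ F, ∀ z, 0 ≤ f z ∧ f z ≤ L) (hα : 0 < P.α)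
    (hσ : ∀ s < P.T, P.α ≤ (w s).2) (hlam : 0 < lam) (hβ : lam ≤ P.β ^ 2)
    (hI : 2 * (1 + P.T * L ^ 2 / P.α ^ 2 / lam) < 2 ^ I)
    (hC : 1 ≤ P.C) (hlog : 1 ≤ Real.log (P.T * P.N / P.δ))
    {f f' : Z → ℝ} (hf : f ∈ F) (hf' : f' ∈ F) (t : ℕ) (ht : t < P.T) :
    wnormSq (subsample P F full w add t) (f - f')
      ≤ 4 * (wnormSq (prefixData w t) (f - f') + P.β ^ 2) := by
  classical
  induction t using Nat.strong_induction_on with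
  | _ t ih =>
    obtain ⟨i, hiI, hi1, hi2⟩ := exists_scale hF hα hσ hlam hβ hI hf hf' ht.le
    have hup := hg.upper f hf f' hf' i hiI t ht
    set x := truncated P F full w add (incrementBound P i) (obsSq w (f - f'))
      (obsSq w (f - f')) with hx
    have hβ0 : 0 < P.β ^ 2 := by linarith
    -- Steps with fewer than two copies are excluded from `x`; there the sampled value never exceeds
    -- the observation itself.
    have hterm : sampledSum P F full w add (obsSq w (f - f')) t ≤
        sampledSum P F full w add x t + ∑ s ∈ Finset.range t, (obsSq w (f - f') s - x s) := by
      unfold sampledSum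
      rw [← Finset.sum_add_distrib]
      refine Finset.sum_le_sum fun s hs => ?_
      have hst : s < t := Finset.mem_range.1 hs
      have hv : 2 ≤ stepCopies P F full w add s →
          stepCopies P F full w add s * obsSq w (f - f') s ≤ incrementBound P i := fun h2 =>
        stepCopies_mul_obsSq_le hβ0 hC hlog hf hf' (ih s hst (hst.trans ht)) h2
          (by linarith [wnormSq_prefix_mono (w := w) (f - f') hst.le])
      have h0 := obsSq_nonneg (w := w) (f - f') s
      by_cases h2 : 2 ≤ stepCopies P F full w add s
      · rw [hx, truncated_of_two_le hv h2]; simp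
      · rw [hx, truncated_of_lt_two (not_le.1 h2)]
        have h1 : (stepCopies P F full w add s : ℝ) ≤ 1 := by
          exact_mod_cast (show stepCopies P F full w add s ≤ 1 by omega)
        split_ifs
        · nlinarith
        · simpa using h0
    have hxle : ∑ s ∈ Finset.range t, x s ≤ ∑ s ∈ Finset.range t, obsSq w (f - f') s :=
      Finset.sum_le_sum fun s _ => truncated_le (obsSq_nonneg _) s
    rw [Finset.sum_sub_distrib] at hterm
    have hN0 := wnormSq_nonneg (prefixData w t) (f - f')
    rw [wnormSq_subsample]
    rw [wnormSq_prefix_eq_sum] at *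
    linarith

/-- With S the sampled and R the full rounded sum, the lower tail gives R/2 ≤ S + (N + β²)/8.
Combined with N ≤ 2R + λ and λ ≤ β², this yields N ≤ 8S + 3β². -/
theorem roundedNormSq_subsample_ge (hg : IsGoodPath P F full κ I nmax l w add)
    (hF : ∀ f ∈ F, ∀ z, 0 ≤ f z ∧ f z ≤ L) (hL : 0 < L) (hα : 0 < P.α)
    (hσ : ∀ s < P.T, P.α ≤ (w s).2) (hlam : 0 < lam) (hβ : lam ≤ P.β ^ 2)
    (hκ : κ = lam / (P.T * L ^ 2))
    (hI : 2 * (1 + P.T * L ^ 2 / P.α ^ 2 / lam) < 2 ^ I)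
    (hC : 1 ≤ P.C) (hlog : 1 ≤ Real.log (P.T * P.N / P.δ))
    {f f' : Z → ℝ} (hf : f ∈ F) (hf' : f' ∈ F) {t : ℕ} (ht : t < P.T) :
    wnormSq (prefixData w t) (f - f') ≤
      8 * roundedNormSq κ (subsample P F full w add t) (f - f') + 3 * P.β ^ 2 := by
  classical
  obtain ⟨i, hiI, hi1, hi2⟩ := exists_scale hF hα hσ hlam hβ hI hf hf' ht.le
  have hlo := hg.lower f hf f' hf' i hiI t ht
  set x := truncated P F full w add (incrementBound P i) (obsSq w (f - f'))
    (obsRoundedSq κ w (f - f')) with hx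
  have hβ0 : 0 < P.β ^ 2 := by linarith
  have hterm : sampledSum P F full w add x t +
        ∑ s ∈ Finset.range t, (obsRoundedSq κ w (f - f') s - x s)
      ≤ sampledSum P F full w add (obsRoundedSq κ w (f - f')) t := by
    unfold sampledSum
    rw [← Finset.sum_add_distrib]
    refine Finset.sum_le_sum fun s hs => ?_
    have hst : s < t := Finset.mem_range.1 hs
    have hv : 2 ≤ stepCopies P F full w add s →
        stepCopies P F full w add s * obsSq w (f - f') s ≤ incrementBound P i := fun h2 =>
      stepCopies_mul_obsSq_le hβ0 hC hlog hf hf'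
        (wnormSq_subsample_le hg hF hα hσ hlam hβ hI hC hlog hf hf' s (hst.trans ht)) h2
        (by linarith [wnormSq_prefix_mono (w := w) (f - f') hst.le])
    by_cases h2 : 2 ≤ stepCopies P F full w add s
    · rw [hx, truncated_of_two_le hv h2]; simp
    · rw [hx, truncated_of_lt_two (not_le.1 h2)]
      -- Steps outside the truncated sum lose nothing: a single copy is added with certainty, and
      -- zero copies occur only for a zero observation.
      by_cases h1 : stepCopies P F full w add s = 1
      · have := hg.forced s (hst.trans ht) h1
        simp [this, h1]
      · have h0 : stepCopies P F full w add s = 0 := by omega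
        have hz := sq_div_eq_zero_of_copies_eq_zero hC hlog hβ0 hf hf' h0
        have hσ0 : 0 < (w s).2 := hα.trans_le (hσ s (hst.trans ht))
        have hz' : obsRoundedSq κ w (f - f') s ≤ 0 := (obsRoundedSq_le _ hσ0).trans_eq hz
        rw [h0]
        simpa using hz'
  have hxle : ∑ s ∈ Finset.range t, x s ≤ ∑ s ∈ Finset.range t, obsRoundedSq κ w (f - f') s :=
    Finset.sum_le_sum fun s _ => truncated_le (obsRoundedSq_nonneg _) s
  rw [Finset.sum_sub_distrib] at hterm
  have hN := wnormSq_prefix_le_rounded (κ := κ) (w := w) hF hL (by omega) hlam hκ hf hf' ht.le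
  rw [roundedNormSq_subsample]
  linarith

theorem roundedNormSq_subsample_le (hα : 0 < P.α) (hσ : ∀ s < P.T, P.α ≤ (w s).2) (g : Z → ℝ)
    {t : ℕ} (ht : t ≤ P.T) :
    roundedNormSq κ (subsample P F full w add t) g ≤ wnormSq (subsample P F full w add t) g := by
  rw [roundedNormSq_subsample, wnormSq_subsample]
  refine Finset.sum_le_sum fun s hs => ?_
  have hσ0 : 0 < (w s).2 := hα.trans_le (hσ s ((Finset.mem_range.1 hs).trans_le ht))
  have := obsRoundedSq_le (κ := κ) g hσ0
  split_ifs
  · gcongr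
  · exact le_rfl

theorem uncertaintySq_ge {f f' : Z → ℝ} (hf : f ∈ F) (hf' : f' ∈ F) (D : WData Z) (z : Z) :
    (f z - f' z) ^ 2 / (wnormSq D (f - f') + lam) ≤ uncertaintySq F lam D z :=
  le_ciSup (f := fun f : F × F =>
      (f.1.1 z - f.2.1 z) ^ 2 / (wnormSq D (f.1.1 - f.2.1) + lam))
    (Set.finite_range _).bddAbove (⟨⟨f, hf⟩, ⟨f', hf'⟩⟩ : F × F)

theorem uncertaintySq_nonneg (hlam : 0 < lam) (D : WData Z) (z : Z) :
    0 ≤ uncertaintySq F lam D z := by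
  refine Real.iSup_nonneg fun f => ?_
  have := wnormSq_nonneg D (f.1.1 - f.2.1)
  positivity

theorem eluderSum_le (w : ℕ → Z × ℝ) (T : ℕ) : eluderSum F lam T w ≤ T := by
  unfold eluderSum
  calc _ ≤ ∑ i ∈ Finset.range T, (1 : ℝ) := Finset.sum_le_sum fun i _ => min_le_left _ _
    _ = T := by simp

theorem eluderSum_le_genEluderDim {α : ℝ} {T : ℕ} (hσ : ∀ s < T, α ≤ (w s).2) :
    eluderSum F lam T w ≤ genEluderDim F lam α T := by
  -- The dimension ranges over infinite sequences with all σ ≥ α, while the data satisfy this only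
  -- before `T`; the irrelevant tail is replaced.
  set w' : ℕ → Z × ℝ := fun s => if s < T then w s else ((w s).1, α) with hw'
  have h1 : ∀ i, α ≤ (w' i).2 := by
    intro i
    simp only [hw']
    split_ifs with h
    · exact hσ i h
    · exact le_rfl
  have h2 : eluderSum F lam T w = eluderSum F lam T w' := by
    unfold eluderSum
    refine Finset.sum_congr rfl fun i hi => ?_
    have hiT : i < T := Finset.mem_range.1 hi
    have e1 : w' i = w i := if_pos hiT
    have e2 : prefixData w' i = prefixData w i :=
      Multiset.map_congr rfl fun s hs => if_pos ((Multiset.mem_range.1 hs).trans hiT)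
    rw [e1, e2]
  rw [h2]
  refine le_ciSup (f := fun w : {w : ℕ → Z × ℝ // ∀ i, α ≤ (w i).2} => eluderSum F lam T w.1)
    ⟨T, ?_⟩ ⟨w', h1⟩
  rintro _ ⟨v, rfl⟩
  exact eluderSum_le v.1 T

/-- The sensitivity denominator is comparable with N + λ. If its inner minimum is the reference
norm, the lower bound on the sub-sample (or identity, for full data) gives the factor 8; if it is
the cap, N ≤ L² · cap gives L². Their sum serves both cases. -/
theorem sensitivity_le_uncertainty (hg : IsGoodPath P F full κ I nmax l w add)
    (hF : ∀ f ∈ F, ∀ z, 0 ≤ f z ∧ f z ≤ L) (hL : 0 < L) (hα : 0 < P.α)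
    (hσ : ∀ s < P.T, P.α ≤ (w s).2) (hlam : 0 < lam) (hβ : lam ≤ P.β ^ 2)
    (hκ : κ = lam / (P.T * L ^ 2))
    (hI : 2 * (1 + P.T * L ^ 2 / P.α ^ 2 / lam) < 2 ^ I)
    (hC : 1 ≤ P.C) (hlog : 1 ≤ Real.log (P.T * P.N / P.δ)) {s : ℕ} (hs : s < P.T) :
    sensitivity P F (refData full (prefixData w s) (subsample P F full w add s)) (w s).1 (w s).2 ≤
      (L ^ 2 + 8) * min 1 (1 / (w s).2 ^ 2 * uncertaintySq F lam (prefixData w s) (w s).1) := by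
  have hU := uncertaintySq_nonneg (F := F) hlam (prefixData w s) (w s).1
  have hLp : 1 ≤ L ^ 2 + 8 := by nlinarith
  rw [mul_min_of_nonneg _ _ (by linarith)]
  refine le_min ((min_le_right _ _).trans (by linarith)) ((min_le_left _ _).trans ?_)
  refine Real.iSup_le (fun f => ?_) (by positivity)
  obtain ⟨⟨f, hf⟩, ⟨f', hf'⟩⟩ := f
  simp only
  set D := refData full (prefixData w s) (subsample P F full w add s) with hD
  set N := wnormSq (prefixData w s) (f - f') with hN
  have hN0 : 0 ≤ N := wnormSq_nonneg _ _
  have hD0 := wnormSq_nonneg D (f - f')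
  have h1 : N ≤ 8 * wnormSq D (f - f') + 3 * P.β ^ 2 := by
    cases full with
    | true => simp only [hD, refData, if_true]; rw [← hN]; nlinarith
    | false =>
      have a := roundedNormSq_subsample_ge hg hF hL hα hσ hlam hβ hκ hI hC hlog hf hf' hs
      have b := roundedNormSq_subsample_le (κ := κ) (F := F) (full := false) (add := add)
        hα hσ (f - f') hs.le
      simp only [hD, refData]
      rw [← hN] at a
      simp only [Bool.false_eq_true, if_false]
      linarith
  have h2 : N ≤ L ^ 2 * (P.T * (P.H + 1) ^ 2 / P.α ^ 2) := by
    refine (wnormSq_prefix_le hF hα hσ hf hf' hs.le).trans ?_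
    have hH : (1 : ℝ) ≤ (P.H + 1) ^ 2 := by
      have : (0 : ℝ) ≤ P.H := by positivity
      nlinarith
    calc (P.T : ℝ) * L ^ 2 / P.α ^ 2 = L ^ 2 * (P.T * 1 / P.α ^ 2) := by ring
      _ ≤ _ := by gcongr
  set M := (P.T : ℝ) * (P.H + 1) ^ 2 / P.α ^ 2 with hM
  have hM0 : 0 ≤ M := by positivity
  have hβ0 : 0 < P.β ^ 2 := by linarith
  have hden : N + lam ≤ (L ^ 2 + 8) * (min (wnormSq D (f - f')) M + P.β ^ 2) := by
    rcases min_choice (wnormSq D (f - f')) M with h | h <;> rw [h] <;> nlinarith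
  have hmin : 0 < min (wnormSq D (f - f')) M + P.β ^ 2 := by positivity
  have hu := uncertaintySq_ge (lam := lam) hf hf' (prefixData w s) (w s).1
  rw [← hN, div_le_iff₀ (by linarith)] at hu
  rw [div_le_iff₀ hmin]
  calc 1 / (w s).2 ^ 2 * (f (w s).1 - f' (w s).1) ^ 2
      ≤ 1 / (w s).2 ^ 2 * (uncertaintySq F lam (prefixData w s) (w s).1 * (N + lam)) := by gcongr
    _ ≤ 1 / (w s).2 ^ 2 * (uncertaintySq F lam (prefixData w s) (w s).1 *
        ((L ^ 2 + 8) * (min (wnormSq D (f - f')) M + P.β ^ 2))) := by gcongr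
    _ = _ := by ring

/-- The number of observations in the sub-sample is bounded by the Eluder dimension. -/
theorem card_added_le (hg : IsGoodPath P F full κ I nmax l w add)
    (hF : ∀ f ∈ F, ∀ z, 0 ≤ f z ∧ f z ≤ L) (hL : 0 < L) (hα : 0 < P.α)
    (hσ : ∀ s < P.T, P.α ≤ (w s).2) (hlam : 0 < lam) (hβ : lam ≤ P.β ^ 2)
    (hκ : κ = lam / (P.T * L ^ 2))
    (hI : 2 * (1 + P.T * L ^ 2 / P.α ^ 2 / lam) < 2 ^ I)
    (hC : 1 ≤ P.C) (hlog : 1 ≤ Real.log (P.T * P.N / P.δ)) (S : Finset ℕ)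
    (hS : ∀ s ∈ S, s < P.T ∧ add s ∧ stepCopies P F full w add s ≠ 0) :
    (S.card : ℝ) ≤ 4 * (P.C * (L ^ 2 + 8) * genEluderDim F lam P.α P.T *
      Real.log (P.T * P.N / P.δ)) + l := by
  classical
  -- Giving each step the value 1/n makes every addition with n ≠ 0 count exactly one.
  have h1 : (S.card : ℝ) ≤
      sampledSum P F full w add (fun s => 1 / (stepCopies P F full w add s : ℝ)) P.T := by
    unfold sampledSum
    calc (S.card : ℝ) = ∑ s ∈ S, (1 : ℝ) := by simp
      _ ≤ ∑ s ∈ S, (if add s then (stepCopies P F full w add s : ℝ) *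
          (1 / (stepCopies P F full w add s : ℝ)) else 0) := by
        refine Finset.sum_le_sum fun s hs => ?_
        obtain ⟨_, h2, h3⟩ := hS s hs
        rw [if_pos h2, mul_one_div_cancel (by exact_mod_cast h3)]
      _ ≤ _ := by
        refine Finset.sum_le_sum_of_subset_of_nonneg
          (fun s hs => Finset.mem_range.2 (hS s hs).1) fun s _ _ => ?_
        split_ifs <;> positivity
  have h2 : ∑ s ∈ Finset.range P.T, 1 / (stepCopies P F full w add s : ℝ) ≤
      2 * (P.C * (L ^ 2 + 8) * eluderSum F lam P.T w * Real.log (P.T * P.N / P.δ)) := by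
    unfold eluderSum
    rw [Finset.mul_sum, Finset.sum_mul, Finset.mul_sum]
    refine Finset.sum_le_sum fun s hs => ?_
    have hsT := Finset.mem_range.1 hs
    have ha := one_div_copies_le (targetProb_nonneg (P := P) (F := F) (by linarith) (by linarith)
      (refData full (prefixData w s) (subsample P F full w add s)) (w s).1 (w s).2)
      (targetProb_le_one _ _ _)
    refine ha.trans ?_
    have hb := sensitivity_le_uncertainty hg hF hL hα hσ hlam hβ hκ hI hC hlog hsT
    refine mul_le_mul_of_nonneg_left ((min_le_right _ _).trans ?_) (by norm_num)
    calc _ ≤ P.C * ((L ^ 2 + 8) *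
          min 1 (1 / (w s).2 ^ 2 * uncertaintySq F lam (prefixData w s) (w s).1)) *
          Real.log (P.T * P.N / P.δ) := by gcongr
      _ = _ := by ring
  have h3 : eluderSum F lam P.T w ≤ genEluderDim F lam P.α P.T := eluderSum_le_genEluderDim hσ
  have h4 := hg.count
  have h5 : P.C * (L ^ 2 + 8) * eluderSum F lam P.T w * Real.log (P.T * P.N / P.δ) ≤
      P.C * (L ^ 2 + 8) * genEluderDim F lam P.α P.T * Real.log (P.T * P.N / P.δ) := by gcongr
  linarith

end GoodPath

/-! ### Domination, sharpness and monotonicity of the bonus -/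

section Bonus

variable {Z : Type*} {F : Finset (Z → ℝ)}

/-- The values over which the bonus at `z` is a maximum, for an arbitrary squared distance `ν`. -/
def bonusValues (F : Finset (Z → ℝ)) (ν : (Z → ℝ) → ℝ) (r : ℝ) (z : Z) : Set ℝ :=
  {y : ℝ | ∃ f₁ ∈ F, ∃ f₂ ∈ F, ν (f₁ - f₂) ≤ r ∧ y = |f₁ z - f₂ z|}

theorem subsampleBonus_eq (κ β : ℝ) (D : WData Z) (z : Z) :
    subsampleBonus F κ β D z = sSup (bonusValues F (roundedNormSq κ D) (10 ^ 2 * β ^ 2) z) := rfl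

theorem bonusValues_finite (ν : (Z → ℝ) → ℝ) (r : ℝ) (z : Z) : (bonusValues F ν r z).Finite := by
  refine ((F ×ˢ F).finite_toSet.image fun p => |p.1 z - p.2 z|).subset ?_
  rintro y ⟨f₁, h₁, f₂, h₂, -, rfl⟩
  exact ⟨(f₁, f₂), by simp [h₁, h₂], rfl⟩

theorem roundedNormSq_zero (κ : ℝ) (D : WData Z) : roundedNormSq κ D 0 = 0 := by
  simp [roundedNormSq]

theorem zero_mem_bonusValues (hF : F.Nonempty) (κ β : ℝ) (D : WData Z) (z : Z) :
    0 ∈ bonusValues F (roundedNormSq κ D) (10 ^ 2 * β ^ 2) z := by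
  obtain ⟨f, hf⟩ := hF
  refine ⟨f, hf, f, hf, ?_, by simp⟩
  rw [sub_self, roundedNormSq_zero]
  positivity

theorem subsampleBonus_nonneg (κ β : ℝ) (D : WData Z) (z : Z) : 0 ≤ subsampleBonus F κ β D z := by
  refine Real.sSup_nonneg ?_
  rintro y ⟨f₁, h₁, f₂, h₂, -, rfl⟩
  exact abs_nonneg _

theorem le_subsampleBonus {κ β : ℝ} {D : WData Z} {f₁ f₂ : Z → ℝ} (h₁ : f₁ ∈ F) (h₂ : f₂ ∈ F)
    (h : roundedNormSq κ D (f₁ - f₂) ≤ 10 ^ 2 * β ^ 2) (z : Z) :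
    |f₁ z - f₂ z| ≤ subsampleBonus F κ β D z :=
  le_csSup (bonusValues_finite (roundedNormSq κ D) (10 ^ 2 * β ^ 2) z).bddAbove
    ⟨f₁, h₁, f₂, h₂, h, rfl⟩

/-- More data shrink the feasible set. It stays nonempty because the diagonal pair is always
feasible, so the suprema compare. -/
theorem subsampleBonus_anti (hF : F.Nonempty) {κ β : ℝ} {D D' : WData Z} (h : D ≤ D') (z : Z) :
    subsampleBonus F κ β D' z ≤ subsampleBonus F κ β D z := by
  rw [subsampleBonus_eq, subsampleBonus_eq]
  refine csSup_le_csSup (bonusValues_finite _ _ _).bddAbove ⟨0, zero_mem_bonusValues hF κ β D' z⟩ ?_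
  rintro y ⟨f₁, h₁, f₂, h₂, h3, rfl⟩
  exact ⟨f₁, h₁, f₂, h₂, (roundedNormSq_mono κ h _).trans h3, rfl⟩

variable {P : Params} {full : Bool} {κ L lam l : ℝ} {I nmax : ℕ}
  {w : ℕ → Z × ℝ} {add : ℕ → Prop}

/-- A pair within β² on the data is within 4(β² + β²) = 8β² on the sub-sample, and rounding down
only decreases this; the threshold is 100β². -/
theorem subsampleBonus_dominates (hg : IsGoodPath P F full κ I nmax l w add)
    (hF : ∀ f ∈ F, ∀ z, 0 ≤ f z ∧ f z ≤ L) (hα : 0 < P.α)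
    (hσ : ∀ s < P.T, P.α ≤ (w s).2) (hlam : 0 < lam) (hβ : lam ≤ P.β ^ 2)
    (hI : 2 * (1 + P.T * L ^ 2 / P.α ^ 2 / lam) < 2 ^ I)
    (hC : 1 ≤ P.C) (hlog : 1 ≤ Real.log (P.T * P.N / P.δ))
    {f f' : Z → ℝ} (hf : f ∈ F) (hf' : f' ∈ F) {t : ℕ} (ht : t < P.T)
    (h : wnormSq (prefixData w t) (f - f') ≤ P.β ^ 2) (z : Z) :
    |f z - f' z| ≤ subsampleBonus F κ P.β (subsample P F full w add t) z := by
  refine le_subsampleBonus hf hf' ?_ z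
  have h1 := wnormSq_subsample_le hg hF hα hσ hlam hβ hI hC hlog hf hf' t ht
  have h2 := roundedNormSq_subsample_le (κ := κ) (F := F) (full := full) (add := add)
    hα hσ (f - f') ht.le
  have : 0 ≤ P.β ^ 2 := sq_nonneg _
  linarith

/-- Feasible pairs satisfy N + λ ≤ (8 · 100 + 3 + 1)β², which is the source of 804; `K` converts β²
into b² + λ. -/
theorem subsampleBonus_le (hg : IsGoodPath P F full κ I nmax l w add) (hFn : F.Nonempty)
    (hF : ∀ f ∈ F, ∀ z, 0 ≤ f z ∧ f z ≤ L) (hL : 0 < L) (hα : 0 < P.α)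
    (hσ : ∀ s < P.T, P.α ≤ (w s).2) (hlam : 0 < lam) (hβ : lam ≤ P.β ^ 2)
    (hκ : κ = lam / (P.T * L ^ 2))
    (hI : 2 * (1 + P.T * L ^ 2 / P.α ^ 2 / lam) < 2 ^ I)
    (hC : 1 ≤ P.C) (hlog : 1 ≤ Real.log (P.T * P.N / P.δ))
    {t : ℕ} (ht : t < P.T) {K b : ℝ} (hK : 1 ≤ K) (hb : P.β ^ 2 ≤ K * (b ^ 2 + lam)) (z : Z) :
    subsampleBonus F κ P.β (subsample P F full w add t) z ≤
      Real.sqrt (804 * K) * (uncertainty F lam (prefixData w t) z * Real.sqrt (b ^ 2 + lam)) := by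
  rw [subsampleBonus_eq]
  refine csSup_le ⟨0, zero_mem_bonusValues hFn κ P.β _ z⟩ ?_
  rintro y ⟨f, hf, f', hf', h, rfl⟩
  have h1 := roundedNormSq_subsample_ge hg hF hL hα hσ hlam hβ hκ hI hC hlog hf hf' ht
  have hu := uncertaintySq_ge (lam := lam) hf hf' (prefixData w t) z
  have hU := uncertaintySq_nonneg (F := F) hlam (prefixData w t) z
  have hN0 := wnormSq_nonneg (prefixData w t) (f - f')
  rw [div_le_iff₀ (by linarith)] at hu
  unfold uncertainty
  rw [← Real.sqrt_mul hU, ← Real.sqrt_mul (by linarith)]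
  refine Real.abs_le_sqrt (hu.trans ?_)
  have hle : wnormSq (prefixData w t) (f - f') + lam ≤ 804 * (K * (b ^ 2 + lam)) := by linarith
  calc _ ≤ uncertaintySq F lam (prefixData w t) z * (804 * (K * (b ^ 2 + lam))) := by gcongr
    _ = _ := by ring

end Bonus

/-! ### Finite encoding of the possible bonuses -/

section BonusClass

variable {Z : Type*}

/-- A point, the exponent of its rounded weight and its multiplicity; `none` is a void entry. -/
abbrev CodeEntry (Z : Type*) (a b : ℤ) (k : ℕ) := Option (Z × Finset.Icc a b × Fin (k + 1))

/-- The contribution of an entry to the squared distance. -/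
noncomputable def entrySq {a b : ℤ} {k : ℕ} (g : Z → ℝ) : CodeEntry Z a b k → ℝ
  | none => 0
  | some (z, j, n) => n.1 * ((2 : ℝ) ^ j.1 * g z ^ 2)

open Classical in
/-- All bonuses obtained from sub-samples with at most `m` distinct observations, rounded weights
`2 ^ j` with `a ≤ j ≤ b` and multiplicities at most `k`. -/
noncomputable def bonusClass [Fintype Z] {H : ℕ} (F : Fin H → Finset (Z → ℝ)) (B : Fin H → ℝ)
    (a b : ℤ) (k m : ℕ) : Finset (Z → ℝ) :=
  Finset.univ.image fun p : Fin H × (Fin m → CodeEntry Z a b k) => fun z =>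
    sSup (bonusValues (F p.1) (fun g => ∑ i, entrySq g (p.2 i)) (10 ^ 2 * B p.1 ^ 2) z)

theorem card_bonusClass_le [Fintype Z] {H : ℕ} (F : Fin H → Finset (Z → ℝ)) (B : Fin H → ℝ)
    (a b : ℤ) (k m : ℕ) : (bonusClass F B a b k m).card ≤
      H * (Fintype.card Z * ((b + 1 - a).toNat * (k + 1)) + 1) ^ m := by
  classical
  refine Finset.card_image_le.trans ?_
  simp [Finset.card_univ]

/-- Padding with `none` turns a set of varying size into a tuple of fixed length without changing
sums that vanish at `none`. -/
theorem exists_fin_code {ι C : Type*} (S : Finset ι) {m : ℕ} (h : S.card ≤ m) (φ : ι → Option C) :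
    ∃ c : Fin m → Option C, ∀ ψ : Option C → ℝ, ψ none = 0 →
      ∑ i, ψ (c i) = ∑ s ∈ S, ψ (φ s) := by
  obtain ⟨e⟩ : Nonempty (S ↪ Fin m) :=
    Function.Embedding.nonempty_of_card_le (by simpa using h)
  refine ⟨Function.extend e (fun s : S => φ s) fun _ => none, fun ψ hψ => ?_⟩
  rw [← Finset.sum_coe_sort S]
  refine (Fintype.sum_of_injective e e.injective _ _ ?_ ?_).symm
  · intro i hi
    rw [Function.extend_apply' _ _ _ (by simpa using hi), hψ]
  · intro s
    rw [e.injective.extend_apply]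

theorem subsampleBonus_mem_bonusClass [Fintype Z] {H : ℕ} {F : Fin H → Finset (Z → ℝ)}
    {B : Fin H → ℝ} {h : Fin H} {P : Params} {full : Bool} {κ : ℝ} {nmax m : ℕ}
    {w : ℕ → Z × ℝ} {add : ℕ → Prop} (hκ : 0 < κ) (hα : 0 < P.α)
    (hσ : ∀ s < P.T, P.α ≤ (w s).2)
    (hcap : ∀ s < P.T, add s → stepCopies P (F h) full w add s ≤ nmax)
    (hcard : ∀ S : Finset ℕ,
      (∀ s ∈ S, s < P.T ∧ add s ∧ stepCopies P (F h) full w add s ≠ 0) → S.card ≤ m)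
    {t : ℕ} (ht : t ≤ P.T) :
    subsampleBonus (F h) κ (B h) (subsample P (F h) full w add t) ∈
      bonusClass F B (Int.log 2 κ) (Int.log 2 (1 / P.α ^ 2)) nmax m := by
  classical
  set n := stepCopies P (F h) full w add with hn
  -- Only observations with a positive number of copies and a weight that is not dropped affect the
  -- rounded norm. The lower cut-off κ and σ ≥ α confine the exponents to a finite range.
  set S : Finset ℕ := (Finset.range t).filter fun s =>
    add s ∧ n s ≠ 0 ∧ κ ≤ 1 / (w s).2 ^ 2 with hS
  have hS1 : ∀ s ∈ S, s < t ∧ add s ∧ n s ≠ 0 ∧ κ ≤ 1 / (w s).2 ^ 2 := by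
    intro s hs
    simpa [hS] using hs
  have hmem : ∀ s ∈ S, Int.log 2 (1 / (w s).2 ^ 2) ∈
      Finset.Icc (Int.log 2 κ) (Int.log 2 (1 / P.α ^ 2)) := by
    intro s hs
    obtain ⟨h1, -, -, h2⟩ := hS1 s hs
    have h3 := hσ s (h1.trans_le ht)
    have h4 : 0 < (w s).2 := hα.trans_le h3
    exact Finset.mem_Icc.2 ⟨Int.log_mono_right hκ h2, Int.log_mono_right (by positivity)
      (one_div_le_one_div_of_le (by positivity) (by gcongr))⟩
  have hle : ∀ s ∈ S, n s < nmax + 1 := by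
    intro s hs
    obtain ⟨h1, h2, -⟩ := hS1 s hs
    exact Nat.lt_succ_of_le (hcap s (h1.trans_le ht) h2)
  let φ : ℕ → CodeEntry Z (Int.log 2 κ) (Int.log 2 (1 / P.α ^ 2)) nmax := fun s =>
    if hs : s ∈ S then some ((w s).1, ⟨_, hmem s hs⟩, ⟨n s, hle s hs⟩) else none
  obtain ⟨c, hc⟩ := exists_fin_code S (m := m) (hcard S fun s hs => by
    obtain ⟨h1, h2, h3, -⟩ := hS1 s hs
    exact ⟨h1.trans_le ht, h2, h3⟩) φ
  have key : ∀ g, roundedNormSq κ (subsample P (F h) full w add t) g = ∑ i, entrySq g (c i) := by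
    intro g
    rw [hc (entrySq g) rfl, roundedNormSq_subsample, sampledSum, hS, Finset.sum_filter]
    refine Finset.sum_congr rfl fun s hs => ?_
    by_cases hsS : s ∈ S
    · obtain ⟨h1, h2, h3, h4⟩ := hS1 s hsS
      rw [if_pos h2, if_pos ⟨h2, h3, h4⟩]
      simp only [φ, dif_pos hsS, entrySq, obsRoundedSq, roundedWeight, if_neg (not_lt.2 h4)]
      rfl
    · have hnot : ¬ (add s ∧ n s ≠ 0 ∧ κ ≤ 1 / (w s).2 ^ 2) := fun hh =>
        hsS (Finset.mem_filter.2 ⟨hs, hh⟩)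
      rw [if_neg hnot]
      by_cases h2 : add s
      · rw [if_pos h2]
        by_cases h3 : n s = 0
        · have : stepCopies P (F h) full w add s = 0 := h3
          simp [this]
        · have h4 : 1 / (w s).2 ^ 2 < κ := by
            by_contra h5
            exact hnot ⟨h2, h3, not_lt.1 h5⟩
          simp only [obsRoundedSq, roundedWeight, if_pos h4]
          simp
      · rw [if_neg h2]
  refine Finset.mem_image.2 ⟨(h, c), Finset.mem_univ _, ?_⟩
  ext z
  rw [subsampleBonus_eq]
  simp only [bonusValues, key]

end BonusClass

/-! ### Probability of a bad path -/

section Probability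

theorem measurable_roundedWeight (κ : ℝ) : Measurable (roundedWeight κ) := by
  have h : roundedWeight κ = fun σ : ℝ =>
      if 1 / σ ^ 2 < κ then 0 else (2 : ℝ) ^ ⌊Real.logb 2 (1 / σ ^ 2)⌋ := by
    ext σ
    have := Real.floor_logb_natCast (b := 2) (r := 1 / σ ^ 2) (by positivity)
    unfold roundedWeight
    rw [← this]
    norm_cast
  rw [h]
  refine Measurable.ite ?_ measurable_const ?_
  · exact measurableSet_lt (by fun_prop) measurable_const
  · have h1 : Measurable fun σ : ℝ => ⌊Real.logb 2 (1 / σ ^ 2)⌋ := by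
      refine Int.measurable_floor.comp ?_
      unfold Real.logb
      fun_prop
    exact (measurable_from_top (f := fun k : ℤ => (2 : ℝ) ^ k)).comp h1

variable {Ω Z : Type*} [Finite Z] {mΩ : MeasurableSpace Ω} {μ : Measure Ω}
  [IsProbabilityMeasure μ] {𝓖 : Filtration ℕ mΩ} {z : ℕ → Ω → Z} {σ : ℕ → Ω → ℝ}
  {add : ℕ → Set Ω} {P : Params} {F : Finset (Z → ℝ)} {full : Bool} {κ l : ℝ} {I nmax : ℕ}

/-- A union bound over the five requirements: both tails for each pair, scale and time; the count;
the almost sure coins; and coins with more than `nmax` copies, each succeeding with probability at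
most 1/(nmax + 1). -/
theorem measure_not_isGoodPath_le
    (hz : ∀ t < P.T, ∀ z₀, MeasurableSet[𝓖 t] {ω | z t ω = z₀})
    (hσ : ∀ t < P.T, Measurable[𝓖 t] (σ t))
    (hσ0 : ∀ t < P.T, ∀ ω, 0 < σ t ω)
    (hadd : ∀ t < P.T, MeasurableSet[𝓖 (t + 1)] (add t))
    (hp : ∀ t < P.T, μ[(add t).indicator (fun _ => (1 : ℝ)) | 𝓖 t] =ᵐ[μ]
      fun ω => addProb P F full (fun t => (z t ω, σ t ω)) (fun s => ω ∈ add s) t)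
    (hβ : 0 < P.β ^ 2) (hC : 1 ≤ P.C) (hlog : 1 ≤ Real.log (P.T * P.N / P.δ)) :
    μ.real {ω | ¬ IsGoodPath P F full κ I nmax l (fun t => (z t ω, σ t ω)) (fun s => ω ∈ add s)} ≤
      2 * (F.card * (F.card * (I * P.T)) *
        Real.exp (-(P.C * Real.log (P.T * P.N / P.δ) / 80))) + Real.exp (-l) +
        P.T * (1 / (nmax + 1)) := by
  classical
  set W : Ω → ℕ → Z × ℝ := fun ω t => (z t ω, σ t ω) with hW
  set n : ℕ → Ω → ℝ := fun s ω => (stepCopies P F full (W ω) (fun s => ω ∈ add s) s : ℝ) with hn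
  have hmeas := measurable_subsample hz hσ hadd P F full
  have hnm' : ∀ s < P.T, Measurable[𝓖 s] fun ω =>
      stepCopies P F full (W ω) (fun s => ω ∈ add s) s := fun s hs => (hmeas s hs).2
  have hnm : ∀ s < P.T, Measurable[𝓖 s] (n s) := fun s hs =>
    measurable_from_top.comp (hnm' s hs)
  have hum : ∀ g : Z → ℝ, ∀ s < P.T, Measurable[𝓖 s] fun ω => obsSq (W ω) g s := fun g s hs =>
    ((measurable_comp_of_levelSets (hz s hs) g).pow_const 2).div ((hσ s hs).pow_const 2)
  have hrm : ∀ g : Z → ℝ, ∀ s < P.T, Measurable[𝓖 s] fun ω => obsRoundedSq κ (W ω) g s :=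
    fun g s hs => ((measurable_roundedWeight κ).comp (hσ s hs)).mul
      ((measurable_comp_of_levelSets (hz s hs) g).pow_const 2)
  have hsum : ∀ (x : ℕ → Ω → ℝ) (t : ℕ) (ω : Ω),
      sampledSum P F full (W ω) (fun s => ω ∈ add s) (fun s => x s ω) t
        = ∑ s ∈ Finset.range t, (add s).indicator (fun ω => n s ω * x s ω) ω := by
    intro x t ω
    unfold sampledSum
    refine Finset.sum_congr rfl fun s _ => ?_
    by_cases h : ω ∈ add s <;> simp [h, hn]
  have htm : ∀ (b : ℝ) (v u : Ω → ℕ → ℝ), (∀ s < P.T, Measurable[𝓖 s] fun ω => v ω s) →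
      (∀ s < P.T, Measurable[𝓖 s] fun ω => u ω s) → ∀ s < P.T, Measurable[𝓖 s] fun ω =>
        truncated P F full (W ω) (fun s => ω ∈ add s) b (v ω) (u ω) s := by
    intro b v u hv hu s hs
    unfold truncated
    -- The truncation condition is known before the coin of step `s`, so truncated increments remain
    -- predictable.
    refine Measurable.ite ?_ (hu s hs) measurable_const
    exact (measurableSet_le measurable_const (hnm' s hs)).inter
      (measurableSet_le ((hnm s hs).mul (hv s hs)) measurable_const)
  have htn : ∀ (b : ℝ) (v u : Ω → ℕ → ℝ) (s : ℕ) (ω : Ω),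
      truncated P F full (W ω) (fun s => ω ∈ add s) b (v ω) (u ω) s = 0 ∨ 1 ≤ n s ω := by
    intro b v u s ω
    unfold truncated
    split_ifs with h
    · right
      have : (1 : ℕ) ≤ stepCopies P F full (W ω) (fun s => ω ∈ add s) s := by omega
      simp only [hn]
      exact_mod_cast this
    · exact Or.inl rfl
  have htb : ∀ (b : ℝ) (v u : Ω → ℕ → ℝ) (s : ℕ) (ω : Ω), 0 < b → u ω s ≤ v ω s →
      n s ω * truncated P F full (W ω) (fun s => ω ∈ add s) b (v ω) (u ω) s ≤ b := by
    intro b v u s ω hb huv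
    unfold truncated
    split_ifs with h
    · exact (mul_le_mul_of_nonneg_left huv (by positivity)).trans h.2
    · simpa using hb.le
  set ℓ := Real.log (P.T * P.N / P.δ) with hℓ
  have hCl : 0 < P.C * ℓ := by positivity
  have hbpos : ∀ i, 0 < incrementBound P i := by
    intro i; unfold incrementBound; rw [← hℓ]; positivity
  -- The constant 80 is 5 · 16: it turns the increment bound into the slack 2^i β²/16 required of a
  -- good path.
  have hbl : ∀ i, incrementBound P i * (P.C * ℓ / 80) = 2 ^ i * P.β ^ 2 / 16 := by
    intro i; unfold incrementBound; rw [← hℓ]; field_simp; ring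
  let xu : (Z → ℝ) → ℕ → ℕ → Ω → ℝ := fun g i s ω =>
    truncated P F full (W ω) (fun s => ω ∈ add s) (incrementBound P i) (obsSq (W ω) g)
      (obsSq (W ω) g) s
  let xl : (Z → ℝ) → ℕ → ℕ → Ω → ℝ := fun g i s ω =>
    truncated P F full (W ω) (fun s => ω ∈ add s) (incrementBound P i) (obsSq (W ω) g)
      (obsRoundedSq κ (W ω) g) s
  let J : Finset ((Z → ℝ) × (Z → ℝ) × ℕ × ℕ) :=
    F ×ˢ (F ×ˢ (Finset.range I ×ˢ Finset.range P.T))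
  let U₁ : (Z → ℝ) × (Z → ℝ) × ℕ × ℕ → Set Ω := fun j =>
    {ω | 2 * ∑ s ∈ Finset.range j.2.2.2, xu (j.1 - j.2.1) j.2.2.1 s ω +
        incrementBound P j.2.2.1 * (P.C * ℓ / 80) ≤
      ∑ s ∈ Finset.range j.2.2.2,
        (add s).indicator (fun ω => n s ω * xu (j.1 - j.2.1) j.2.2.1 s ω) ω}
  let U₂ : (Z → ℝ) × (Z → ℝ) × ℕ × ℕ → Set Ω := fun j =>
    {ω | ∑ s ∈ Finset.range j.2.2.2,
        (add s).indicator (fun ω => n s ω * xl (j.1 - j.2.1) j.2.2.1 s ω) ω ≤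
      (∑ s ∈ Finset.range j.2.2.2, xl (j.1 - j.2.1) j.2.2.1 s ω) / 2 -
        incrementBound P j.2.2.1 * (P.C * ℓ / 80)}
  let U₃ : Set Ω := {ω | 2 * ∑ s ∈ Finset.range P.T, 1 / n s ω + 1 * l ≤
      ∑ s ∈ Finset.range P.T, (add s).indicator (fun ω => n s ω * (1 / n s ω)) ω}
  let U₄ : ℕ → Set Ω := fun s =>
    {ω | stepCopies P F full (W ω) (fun s => ω ∈ add s) s = 1} \ add s
  let U₅ : ℕ → Set Ω := fun s =>
    {ω | nmax + 1 ≤ stepCopies P F full (W ω) (fun s => ω ∈ add s) s} ∩ add s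
  have hU₁ : ∀ j ∈ J, μ.real (U₁ j) ≤ Real.exp (-(P.C * ℓ / 80)) := by
    intro j hj
    obtain ⟨-, -, -, hjT⟩ : j.1 ∈ F ∧ j.2.1 ∈ F ∧ j.2.2.1 < I ∧ j.2.2.2 < P.T := by
      simpa [J] using hj
    exact measure_copies_upper (hbpos _) hadd hp hnm
      (htm _ (fun ω => obsSq (W ω) _) (fun ω => obsSq (W ω) _) (hum _) (hum _))
      (fun s _ ω => truncated_nonneg (obsSq_nonneg _) s)
      (fun s _ ω => htn _ (fun ω => obsSq (W ω) _) (fun ω => obsSq (W ω) _) s ω)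
      (fun s _ ω => htb _ (fun ω => obsSq (W ω) _) (fun ω => obsSq (W ω) _) s ω (hbpos _) le_rfl)
      hjT.le _
  have hU₂ : ∀ j ∈ J, μ.real (U₂ j) ≤ Real.exp (-(P.C * ℓ / 80)) := by
    intro j hj
    obtain ⟨-, -, -, hjT⟩ : j.1 ∈ F ∧ j.2.1 ∈ F ∧ j.2.2.1 < I ∧ j.2.2.2 < P.T := by
      simpa [J] using hj
    exact measure_copies_lower (hbpos _) hadd hp hnm
      (htm _ (fun ω => obsSq (W ω) _) (fun ω => obsRoundedSq κ (W ω) _) (hum _) (hrm _))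
      (fun s _ ω => truncated_nonneg (obsRoundedSq_nonneg _) s)
      (fun s _ ω => htn _ (fun ω => obsSq (W ω) _) (fun ω => obsRoundedSq κ (W ω) _) s ω)
      (fun s hs ω => htb _ (fun ω => obsSq (W ω) _) (fun ω => obsRoundedSq κ (W ω) _) s ω
        (hbpos _) (obsRoundedSq_le _ (hσ0 s hs ω)))
      hjT.le _
  have hU₃ : μ.real U₃ ≤ Real.exp (-l) := by
    refine measure_copies_upper (n := n) (x := fun s ω => 1 / n s ω) one_pos hadd hp hnm
      (fun s hs => measurable_const.div (hnm s hs)) (fun s _ ω => by simp only [hn]; positivity)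
      (fun s _ ω => ?_) (fun s _ ω => ?_) le_rfl l
    · rcases Nat.eq_zero_or_pos (stepCopies P F full (W ω) (fun s => ω ∈ add s) s) with h | h
      · left; simp [hn, h]
      · right; simp only [hn]; exact_mod_cast h
    · rw [mul_one_div]; exact div_self_le_one _
  have hU₄ : ∀ s ∈ Finset.range P.T, μ.real (U₄ s) ≤ 0 := by
    intro s hs
    have hsT := Finset.mem_range.1 hs
    refine (measure_inter_compl_coin (𝓖.le s) (𝓖.le _ _ (hadd s hsT))
      (hnm' s hsT (measurableSet_singleton 1)) (hp s hsT) ?_).le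
    intro ω hω
    have : stepCopies P F full (W ω) (fun s => ω ∈ add s) s = 1 := hω
    change 1 / (stepCopies P F full (W ω) (fun s => ω ∈ add s) s : ℝ) = 1
    rw [this]; simp
  have hU₅ : ∀ s ∈ Finset.range P.T, μ.real (U₅ s) ≤ 1 / (nmax + 1) := by
    intro s hs
    have hsT := Finset.mem_range.1 hs
    refine measure_inter_coin_le (𝓖.le s) (𝓖.le _ _ (hadd s hsT))
      (measurableSet_le measurable_const (hnm' s hsT)) (hp s hsT) (by positivity) ?_
    intro ω hω
    have h1 : nmax + 1 ≤ stepCopies P F full (W ω) (fun s => ω ∈ add s) s := hω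
    have h2 : ((nmax : ℝ) + 1) ≤ stepCopies P F full (W ω) (fun s => ω ∈ add s) s := by
      exact_mod_cast h1
    exact one_div_le_one_div_of_le (by positivity) h2
  have hsub : {ω | ¬ IsGoodPath P F full κ I nmax l (W ω) (fun s => ω ∈ add s)} ⊆
      (((⋃ j ∈ J, U₁ j) ∪ (⋃ j ∈ J, U₂ j)) ∪ U₃) ∪
        ((⋃ s ∈ Finset.range P.T, U₄ s) ∪ (⋃ s ∈ Finset.range P.T, U₅ s)) := by
    intro ω hω
    by_contra hnot
    apply hω
    simp only [Set.mem_union, Set.mem_iUnion, not_or, not_exists] at hnot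
    obtain ⟨⟨⟨h1, h2⟩, h3⟩, h4, h5⟩ := hnot
    refine ⟨?_, ?_, ?_, ?_, ?_⟩
    · intro f hf f' hf' i hi t ht
      have h := h1 (f, f', i, t) (by simp [J, hf, hf', hi, ht])
      simp only [U₁, Set.mem_ofPred_eq, not_le] at h
      replace h := h.le
      rw [hbl] at h
      rw [← hsum (xu (f - f') i)] at h
      exact h
    · intro f hf f' hf' i hi t ht
      have h := h2 (f, f', i, t) (by simp [J, hf, hf', hi, ht])
      simp only [U₂, Set.mem_ofPred_eq, not_le] at h
      replace h := h.le
      rw [hbl] at h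
      rw [← hsum (xl (f - f') i)] at h
      exact h
    · intro s hs h
      by_contra hadd'
      exact h4 s (Finset.mem_range.2 hs) ⟨h, hadd'⟩
    · simp only [U₃, Set.mem_ofPred_eq, not_le] at h3
      have h := h3.le
      rw [← hsum (fun s ω => 1 / n s ω), one_mul] at h
      exact h
    · intro s hs h
      by_contra hlt
      exact h5 s (Finset.mem_range.2 hs) ⟨Nat.succ_le_of_lt (not_le.1 hlt), h⟩
  have hJ : (J.card : ℝ) = F.card * (F.card * (I * P.T)) := by
    simp [J, Finset.card_product]
  calc μ.real _ ≤ _ := measureReal_mono hsub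
    _ ≤ _ := measureReal_union_le _ _
    _ ≤ (μ.real ((⋃ j ∈ J, U₁ j) ∪ (⋃ j ∈ J, U₂ j)) + μ.real U₃) +
        (μ.real (⋃ s ∈ Finset.range P.T, U₄ s) + μ.real (⋃ s ∈ Finset.range P.T, U₅ s)) :=
      add_le_add (measureReal_union_le _ _) (measureReal_union_le _ _)
    _ ≤ ((∑ j ∈ J, Real.exp (-(P.C * ℓ / 80)) + ∑ j ∈ J, Real.exp (-(P.C * ℓ / 80))) +
        Real.exp (-l)) +
        (∑ s ∈ Finset.range P.T, (0 : ℝ) + ∑ s ∈ Finset.range P.T, 1 / ((nmax : ℝ) + 1)) := by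
      refine add_le_add (add_le_add ((measureReal_union_le _ _).trans (add_le_add ?_ ?_)) hU₃)
        (add_le_add ?_ ?_)
      · exact (measureReal_biUnion_finset_le _ _).trans (Finset.sum_le_sum hU₁)
      · exact (measureReal_biUnion_finset_le _ _).trans (Finset.sum_le_sum hU₂)
      · exact (measureReal_biUnion_finset_le _ _).trans (Finset.sum_le_sum hU₄)
      · exact (measureReal_biUnion_finset_le _ _).trans (Finset.sum_le_sum hU₅)
    _ = _ := by
      simp only [Finset.sum_const, nsmul_eq_mul, hJ, Finset.card_range]
      ring

end Probability

/-! ### Numerical estimates -/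

section Numerics

theorem one_le_log_div {x δ : ℝ} (hx : 1 ≤ x) (hδ : 0 < δ) (hδ' : δ * 12 < 1) :
    1 ≤ Real.log (x / δ) := by
  rw [Real.le_log_iff_exp_le (by positivity), le_div_iff₀ hδ]
  have := Real.exp_one_lt_d9
  nlinarith

/-- A constant factor is absorbed by a power of a number whose logarithm is at least one. -/
theorem mul_pow_le_exp {y a b x : ℝ} (hy : 1 ≤ y) (ha : 0 ≤ a)
    (hx : Real.exp x = y) (hx1 : 1 ≤ x) (h : b ≤ a * y ^ 3) : b ≤ Real.exp ((3 + a) * x) := by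
  have h1 : a ≤ Real.exp (a * x) := by
    have := Real.add_one_le_exp (a * x)
    nlinarith
  have h2 : Real.exp ((3 + a) * x) = y ^ 3 * Real.exp (a * x) := by
    rw [← hx, ← Real.exp_nat_mul, ← Real.exp_add]; congr 1; push_cast; ring
  rw [h2]
  calc b ≤ a * y ^ 3 := h
    _ ≤ Real.exp (a * x) * y ^ 3 := by gcongr
    _ = _ := by ring

/-- Each of the three failure sources gets δ/(3H). For the tails, H² ≤ 1/δ reduces all polynomial
factors to 18G(TN/δ)³, which the exponent 3 + 18G absorbs. -/
theorem failure_le {T H N c I G δ k : ℝ} (hT : 1 ≤ T) (hH : 1 ≤ H) (hN : 1 ≤ N) (hc0 : 0 ≤ c)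
    (hc : c ≤ N) (hG : 1 ≤ G) (hI0 : 0 ≤ I) (hI : I ≤ 3 * G * T ^ 2 * H) (hδ : 0 < δ)
    (hδ' : δ * 12 < 1) (hHδ : H ^ 2 * δ ≤ 1) (hk : 3 * T * H / δ ≤ k) :
    H * (2 * (c * (c * (I * T)) * Real.exp (-(80 * (3 + 18 * G) * Real.log (T * N / δ) / 80))) +
      Real.exp (-Real.log (3 * H / δ)) + T * (1 / (k + 1))) ≤ δ := by
  have hTN : 1 ≤ T * N := by nlinarith
  have hlog := one_le_log_div hTN hδ hδ'
  set x := Real.log (T * N / δ) with hx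
  have hy : Real.exp x = T * N / δ := Real.exp_log (by positivity)
  have hy1 : 1 ≤ T * N / δ := by rw [le_div_iff₀ hδ]; nlinarith
  have hcI : c * (c * (I * T)) ≤ N * (N * (3 * G * T ^ 2 * H * T)) := by gcongr
  have hHle : H ^ 2 ≤ 1 / δ := by rw [le_div_iff₀ hδ]; exact hHδ
  have hbig : 6 * H / δ * (N * (N * (3 * G * T ^ 2 * H * T))) ≤ Real.exp ((3 + 18 * G) * x) := by
    refine mul_pow_le_exp hy1 (by positivity) hy hlog ?_
    calc 6 * H / δ * (N * (N * (3 * G * T ^ 2 * H * T)))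
        = 18 * G * (N ^ 2 * T ^ 3 * H ^ 2 / δ) := by ring
      _ ≤ 18 * G * (N ^ 2 * T ^ 3 * (1 / δ) / δ) := by gcongr
      _ ≤ 18 * G * (N ^ 2 * N * T ^ 3 * (1 / δ) / δ * (1 / δ)) := by
          have h1 : 1 ≤ N * (1 / δ) := by
            rw [mul_one_div, le_div_iff₀ hδ]; nlinarith
          have h0 : 0 ≤ N ^ 2 * T ^ 3 * (1 / δ) / δ := by positivity
          have : N ^ 2 * N * T ^ 3 * (1 / δ) / δ * (1 / δ)
            = (N ^ 2 * T ^ 3 * (1 / δ) / δ) * (N * (1 / δ)) := by ring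
          rw [this]
          gcongr
          nlinarith
      _ = 18 * G * (T * N / δ) ^ 3 := by ring
  have e1 : -(80 * (3 + 18 * G) * x / 80) = -((3 + 18 * G) * x) := by ring
  have h1 : 2 * (c * (c * (I * T)) * Real.exp (-(80 * (3 + 18 * G) * x / 80))) ≤ δ / (3 * H) := by
    rw [e1, Real.exp_neg, ← div_eq_mul_inv, ← mul_div_assoc, div_le_iff₀ (Real.exp_pos _)]
    calc 2 * (c * (c * (I * T))) ≤ 2 * (N * (N * (3 * G * T ^ 2 * H * T))) := by gcongr
      _ = δ / (3 * H) * (6 * H / δ * (N * (N * (3 * G * T ^ 2 * H * T)))) := by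
          field_simp; ring
      _ ≤ _ := by gcongr
  have h2 : Real.exp (-Real.log (3 * H / δ)) = δ / (3 * H) := by
    rw [Real.exp_neg, Real.exp_log (by positivity), inv_div]
  have hk0 : 0 < k := lt_of_lt_of_le (by positivity) hk
  have h3 : T * (1 / (k + 1)) ≤ δ / (3 * H) := by
    rw [div_le_iff₀ hδ] at hk
    rw [mul_one_div, div_le_div_iff₀ (by linarith) (by positivity)]
    nlinarith
  rw [h2]
  calc _ ≤ H * (δ / (3 * H) + δ / (3 * H) + δ / (3 * H)) := by gcongr
    _ = δ := by field_simp; ring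

/-- The crude d ≤ 2^d suffices, since the number of exponents enters the final bound only through a
logarithm. -/
theorem toNat_log_sub_le {r κ : ℝ} (hr : 0 < r) (hκ : 0 < κ) :
    ((Int.log 2 r + 1 - Int.log 2 κ).toNat : ℝ) ≤ 4 * (r / κ) := by
  set a := Int.log 2 κ
  set b := Int.log 2 r
  rcases le_or_gt (b + 1 - a) 0 with h | h
  · rw [Int.toNat_of_nonpos h]; simp; positivity
  · have h1 : ((b + 1 - a).toNat : ℝ) ≤ 2 ^ (b + 1 - a).toNat := by
      exact_mod_cast (Nat.lt_two_pow_self (n := (b + 1 - a).toNat)).le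
    have h2 : (2 : ℝ) ^ (b + 1 - a).toNat = 2 ^ (b + 1 - a) := by
      rw [← zpow_natCast, Int.toNat_of_nonneg h.le]
    have h3 : (2 : ℝ) ^ b ≤ r := by
      exact_mod_cast Int.zpow_log_le_self (b := 2) (by norm_num) hr
    have h4 : κ ≤ (2 : ℝ) ^ (a + 1) := by
      exact_mod_cast (Int.lt_zpow_succ_log_self (b := 2) (by norm_num) κ).le
    have h5 : (2 : ℝ) ^ (b + 1 - a) = 4 * (2 ^ b / 2 ^ (a + 1)) := by
      rw [← zpow_sub₀ (by norm_num), show b + 1 - a = 2 + (b - (a + 1)) by ring,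
        zpow_add₀ (by norm_num)]
      norm_num
    rw [h2, h5] at h1
    refine h1.trans ?_
    gcongr

/-- The number of codes per entry is polynomial in T|Z|/δ, after H² ≤ 1/δ has removed `H`; its
logarithm is multiplied by the code length m D x. The factor `H` for the level costs one further
logarithm. -/
theorem log_card_le {T H Z J k G δ m D x card : ℝ} {M : ℕ} (hT : 1 ≤ T) (hH : 1 ≤ H) (hZ : 1 ≤ Z)
    (hJ0 : 0 ≤ J) (hJ : J ≤ 4 * (G * T ^ 2 * H)) (hG : 1 ≤ G) (hk0 : 0 ≤ k)
    (hk : k ≤ 3 * T * H / δ + 1) (hδ : 0 < δ) (hδ' : δ * 12 < 1) (hHδ : H ^ 2 * δ ≤ 1)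
    (hx : 1 ≤ x) (hD : 1 ≤ D) (hm0 : 0 ≤ m) (hM : M ≤ m * D * x)
    (hcard : 0 ≤ card) (hle : card ≤ H * (Z * (J * (k + 1)) + 1) ^ M) :
    Real.log card ≤ (1 + m * (21 * G + 3)) * D * x * Real.log (T * Z / δ) := by
  have hTZ : 1 ≤ T * Z := by nlinarith
  have hlog := one_le_log_div hTZ hδ hδ'
  set y := Real.log (T * Z / δ) with hy
  have hyexp : Real.exp y = T * Z / δ := Real.exp_log (by positivity)
  have hy1 : 1 ≤ T * Z / δ := by rw [le_div_iff₀ hδ]; nlinarith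
  have hHle : H ^ 2 ≤ 1 / δ := by rw [le_div_iff₀ hδ]; exact hHδ
  have hDx : 1 ≤ D * x := by nlinarith
  rcases hcard.eq_or_lt with h | hpos
  · rw [← h, Real.log_zero]; positivity
  have hE0 : 1 ≤ Z * (J * (k + 1)) + 1 := by
    have : 0 ≤ Z * (J * (k + 1)) := by positivity
    linarith
  have hTHδ : 1 ≤ T * H / δ := by
    rw [le_div_iff₀ hδ]; nlinarith
  have hE : Z * (J * (k + 1)) + 1 ≤ Real.exp ((3 + 21 * G) * y) := by
    refine mul_pow_le_exp hy1 (by positivity) hyexp hlog ?_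
    have hk' : k + 1 ≤ 5 * (T * H / δ) := by
      have : 3 * T * H / δ = 3 * (T * H / δ) := by ring
      linarith
    have h1 : Z * (J * (k + 1)) ≤ Z * (4 * (G * T ^ 2 * H) * (5 * (T * H / δ))) := by gcongr
    have h2 : Z * (4 * (G * T ^ 2 * H) * (5 * (T * H / δ))) = 20 * G * (Z * T ^ 3 * H ^ 2 / δ) := by
      ring
    have h3 : Z * T ^ 3 * H ^ 2 / δ ≤ (T * Z / δ) ^ 3 := by
      calc Z * T ^ 3 * H ^ 2 / δ ≤ Z * T ^ 3 * (1 / δ) / δ := by gcongr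
        _ = Z * T ^ 3 / δ ^ 2 * 1 := by ring
        _ ≤ Z * T ^ 3 / δ ^ 2 * (Z ^ 2 / δ) := by
            gcongr
            rw [le_div_iff₀ hδ]; nlinarith
        _ = _ := by ring
    have h4 : 1 ≤ G * (T * Z / δ) ^ 3 := by
      have : 1 ≤ (T * Z / δ) ^ 3 := one_le_pow₀ hy1
      nlinarith
    have h5 : 20 * G * (Z * T ^ 3 * H ^ 2 / δ) ≤ 20 * G * (T * Z / δ) ^ 3 := by gcongr
    linarith
  have hlogE : Real.log (Z * (J * (k + 1)) + 1) ≤ (3 + 21 * G) * y :=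
    (Real.log_le_iff_le_exp (by linarith)).2 hE
  have hlogE0 : 0 ≤ Real.log (Z * (J * (k + 1)) + 1) := Real.log_nonneg hE0
  have hlogH : Real.log H ≤ y := by
    refine Real.log_le_log (by linarith) ?_
    calc H ≤ H ^ 2 := by nlinarith
      _ ≤ 1 / δ := hHle
      _ ≤ T * Z / δ := by gcongr
  calc Real.log card ≤ Real.log (H * (Z * (J * (k + 1)) + 1) ^ M) := Real.log_le_log hpos hle
    _ = Real.log H + M * Real.log (Z * (J * (k + 1)) + 1) := by
        rw [Real.log_mul (by positivity) (by positivity), Real.log_pow]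
    _ ≤ y + (m * D * x) * ((3 + 21 * G) * y) := by gcongr
    _ ≤ (D * x) * y + (m * D * x) * ((3 + 21 * G) * y) := by
        have : y ≤ (D * x) * y := by nlinarith
        linarith
    _ = _ := by ring

/-- Both 3 and `H` are at most 1/δ, and 1/δ ≤ TN/δ, so the argument on the left is at most the cube
of that on the right. -/
theorem log_div_le_three_mul_log {T H N δ : ℝ} (hT : 1 ≤ T) (hH : 1 ≤ H) (hN : 1 ≤ N)
    (hδ : 0 < δ) (hδ' : δ * 12 < 1) (hHδ : H ^ 2 * δ ≤ 1) :
    Real.log (3 * H / δ) ≤ 3 * Real.log (T * N / δ) := by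
  have h3 : (3 : ℝ) * Real.log (T * N / δ) = Real.log ((T * N / δ) ^ 3) := by
    rw [Real.log_pow]; norm_num
  rw [h3]
  refine Real.log_le_log (by positivity) ?_
  have hy : 1 / δ ≤ T * N / δ := by gcongr; nlinarith
  have h12 : 3 ≤ 1 / δ := by rw [le_div_iff₀ hδ]; linarith
  have hHd : H ≤ 1 / δ := by rw [le_div_iff₀ hδ]; nlinarith
  calc 3 * H / δ = 3 * H * (1 / δ) := by ring
    _ ≤ (1 / δ) * (1 / δ) * (1 / δ) := by gcongr
    _ = (1 / δ) ^ 3 := by ring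
    _ ≤ _ := by gcongr

theorem two_mul_scale_le {T H L lam α : ℝ} (hlam : 0 < lam) (hT : 1 ≤ T) (hH : 1 ≤ H)
    (hα : 1 / α ^ 2 ≤ T * H) :
    2 * (1 + T * L ^ 2 / α ^ 2 / lam) ≤ 2 * ((1 + L ^ 2 / lam) * T ^ 2 * H) := by
  have h2 : T * L ^ 2 / α ^ 2 / lam = T * (L ^ 2 / lam) * (1 / α ^ 2) := by ring
  have h3 : T * (L ^ 2 / lam) * (1 / α ^ 2) ≤ T * (L ^ 2 / lam) * (T * H) := by gcongr
  have h4 : 1 ≤ T ^ 2 * H := one_le_mul_of_one_le_of_one_le (one_le_pow₀ hT) hH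
  rw [h2]
  linarith

theorem div_threshold_le {T H L lam α : ℝ} (hL : 0 < L) (hlam : 0 < lam) (hT : 1 ≤ T) (hH : 1 ≤ H)
    (hα : 1 / α ^ 2 ≤ T * H) :
    1 / α ^ 2 / (lam / (T * L ^ 2)) ≤ (1 + L ^ 2 / lam) * T ^ 2 * H := by
  have h1 : 1 / α ^ 2 / (lam / (T * L ^ 2)) = (1 / α ^ 2) * (T * (L ^ 2 / lam)) := by
    field_simp
  have h2 : (1 / α ^ 2) * (T * (L ^ 2 / lam)) ≤ (T * H) * (T * (L ^ 2 / lam)) := by gcongr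
  have h3 : 0 ≤ T ^ 2 * H := by positivity
  rw [h1]
  linarith

end Numerics

end BonusOracle

/-! ### Choice of constants and assembly -/

open MeasureTheory BonusOracle in
theorem mainTheorem4 (L lam : ℝ) (hL : 0 < L) (hlam : 0 < lam) :
    ∃ Calg Cw : ℝ, 1 ≤ Calg ∧ 0 < Cw ∧ ∀ K : ℝ, 1 ≤ K → ∃ Cb : ℝ, 0 < Cb ∧
    ∀ (X A : Type*) [Fintype X] [Fintype A] [Nonempty X] [Nonempty A]
      (T H : ℕ) (_ : 1 ≤ T) (_ : 1 ≤ H)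
      (F : Fin H → Finset (X × A → ℝ)) (_ : ∀ h, (F h).Nonempty)
      (_ : ∀ h, ∀ f ∈ F h, ∀ z, 0 ≤ f z ∧ f z ≤ L)
      (α δ : ℝ) (_ : Real.sqrt (1 / (T * H)) ≤ α) (_ : 0 < δ) (_ : δ < 1 / ((H : ℝ) ^ 2 + 11))
      -- the radii of the oracle calls, nondecreasing in `t`, and the radius `B h` with which the
      -- sub-sampling is run at level `h`
      (β : Fin H → ℕ → ℝ) (B : Fin H → ℝ)
      (_ : ∀ h t, t < T → 0 ≤ β h t ∧ β h t ≤ B h ∧ B h ^ 2 ≤ K * (β h t ^ 2 + lam))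
      (_ : ∀ h t t', t ≤ t' → t' < T → β h t ≤ β h t')
      (_ : ∀ h, lam ≤ B h ^ 2)
      (full : Bool),
      ∃ W : Finset (X × A → ℝ),
        Real.log W.card ≤ Cw * max 1 (⨆ h, genEluderDim (F h) lam α T)
          * Real.log (T * maxCard F / δ) * Real.log (T * Fintype.card (X × A) / δ) ∧
        -- an arbitrary adaptive data process: `𝓖 t` is all that is known just before the coins of
        -- step `t` are tossed, `add h t` is the event that the coin at `(h, t)` says "add"
        ∀ (Ω : Type*) [mΩ : MeasurableSpace Ω] (μ : Measure Ω) [IsProbabilityMeasure μ]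
          (𝓖 : Filtration ℕ mΩ)
          (z : Fin H → ℕ → Ω → X × A) (σ : Fin H → ℕ → Ω → ℝ) (add : Fin H → ℕ → Set Ω)
          (w : Fin H → Ω → ℕ → (X × A) × ℝ) (_ : w = fun h ω t => (z h t ω, σ h t ω))
          (P : Fin H → Params) (_ : P = fun h => ⟨T, H, maxCard F, Calg, B h, α, δ⟩)
          (_ : ∀ h t, t < T → ∀ z₀, MeasurableSet[𝓖 t] {ω | z h t ω = z₀})
          (_ : ∀ h t, t < T → Measurable[𝓖 t] (σ h t))
          (_ : ∀ h t, t < T → ∀ ω, α ≤ σ h t ω)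
          (_ : ∀ h t, t < T → MeasurableSet[𝓖 (t + 1)] (add h t))
          (_ : ∀ h t, t < T → μ[(add h t).indicator (fun _ => (1 : ℝ)) | 𝓖 t] =ᵐ[μ]
            fun ω => addProb (P h) (F h) full (w h ω) (fun s => ω ∈ add h s) t),
          μ {ω | ¬ IsConsistentBonusFamily W Cb lam 0 T F (fun h => w h ω) β
              (fun h t => subsampleBonus (F h) (lam / (T * L ^ 2)) (B h)
                (subsample (P h) (F h) full (w h ω) (fun s => ω ∈ add h s) t))}
            ≤ ENNReal.ofReal δ := by
  set G : ℝ := 1 + L ^ 2 / lam with hGdef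
  have hG : 1 ≤ G := by
    have : 0 ≤ L ^ 2 / lam := by positivity
    linarith
  set C : ℝ := 80 * (3 + 18 * G) with hCdef
  have hC : 1 ≤ C := by linarith
  -- The first term comes from the count of sampled points; the 3 absorbs the deviation `l`, at most
  -- three times the main logarithm.
  set m₀ : ℝ := 4 * (C * (L ^ 2 + 8)) + 3 with hm₀def
  have hm₀ : 0 < m₀ := by positivity
  refine ⟨C, 1 + m₀ * (21 * G + 3), hC, by positivity, fun K hK => ⟨Real.sqrt (804 * K),
    Real.sqrt_pos.2 (by linarith), ?_⟩⟩
  intro X A _ _ _ _ T H hT hH F hFn hF α δ hα hδ hδ' β B hβB hβmono hBlam full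
  have hT' : (1 : ℝ) ≤ T := by exact_mod_cast hT
  have hH' : (1 : ℝ) ≤ H := by exact_mod_cast hH
  have hTH : (0 : ℝ) < T * H := by positivity
  have hα0 : 0 < α := lt_of_lt_of_le (Real.sqrt_pos.2 (by positivity)) hα
  have hα2 : 1 / α ^ 2 ≤ T * H := by
    have h1 : 1 / ((T : ℝ) * H) ≤ α ^ 2 := Real.sqrt_le_left hα0.le |>.1 hα
    rw [div_le_iff₀ hTH] at h1
    rw [div_le_iff₀ (by positivity)]
    linarith
  have hδ1 : δ * ((H : ℝ) ^ 2 + 11) < 1 := (lt_div_iff₀ (by positivity)).1 hδ'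
  have hH2 : (1 : ℝ) ≤ (H : ℝ) ^ 2 := one_le_pow₀ hH'
  have hδ12 : δ * 12 < 1 := by
    have := mul_le_mul_of_nonneg_left hH2 hδ.le
    linarith
  have hHδ : (H : ℝ) ^ 2 * δ ≤ 1 := by linarith
  set N := maxCard F with hNdef
  have hcard : ∀ h, (F h).card ≤ N := fun h =>
    Finset.le_sup (f := fun h => (F h).card) (Finset.mem_univ h)
  have hN : (1 : ℝ) ≤ N := by
    have h1 := (Finset.card_pos.2 (hFn ⟨0, hH⟩)).trans_le (hcard ⟨0, hH⟩)
    exact_mod_cast h1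
  have hlog : 1 ≤ Real.log (T * N / δ) := 
    one_le_log_div (one_le_mul_of_one_le_of_one_le hT' hN) hδ hδ12
  set ℓ := Real.log (T * N / δ) with hℓ
  set D := max 1 (⨆ h, genEluderDim (F h) lam α T) with hDdef
  have hD : 1 ≤ D := le_max_left _ _
  have hDh : ∀ h, genEluderDim (F h) lam α T ≤ D := fun h =>
    (le_ciSup (f := fun h => genEluderDim (F h) lam α T) (Set.finite_range _).bddAbove h).trans
      (le_max_right _ _)
  set κ := lam / (T * L ^ 2) with hκ
  have hκ0 : 0 < κ := by positivity
  -- At this cap, T rare additions at one level have total probability at most δ/(3H).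
  set nmax := ⌈3 * T * H / δ⌉₊ with hnmax
  set l := Real.log (3 * H / δ) with hl
  have hl3 : l ≤ 3 * ℓ := log_div_le_three_mul_log hT' hH' hN hδ hδ12 hHδ
  set m := ⌊m₀ * D * ℓ⌋₊ with hm
  -- Logarithmically many scales would do, but a polynomial number is harmless in the union bound
  -- and makes the required inequality follow from I < 2^I.
  set I := ⌈2 * (G * T ^ 2 * H)⌉₊ with hI
  have hGT : 1 ≤ G * T ^ 2 * H := by
    have : (1 : ℝ) ≤ T ^ 2 := one_le_pow₀ hT'
    calc (1 : ℝ) = 1 * 1 * 1 := by ring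
      _ ≤ _ := by gcongr
  have hIle : (I : ℝ) ≤ 3 * G * T ^ 2 * H := by
    have := (Nat.ceil_lt_add_one (a := 2 * (G * T ^ 2 * H)) (by positivity)).le
    linarith
  have hI2 : 2 * (1 + T * L ^ 2 / α ^ 2 / lam) < 2 ^ I := by
    have h1 : (I : ℝ) < 2 ^ I := by exact_mod_cast Nat.lt_two_pow_self
    exact ((two_mul_scale_le hlam hT' hH' hα2).trans (Nat.le_ceil _)).trans_lt h1
  refine ⟨bonusClass F B (Int.log 2 κ) (Int.log 2 (1 / α ^ 2)) nmax m, ?_, ?_⟩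
  · refine log_card_le (M := m) (J := ((Int.log 2 (1 / α ^ 2) + 1 - Int.log 2 κ).toNat : ℝ))
      (k := nmax) hT' hH' ?_ (by positivity) ?_ hG (by positivity) ?_ hδ hδ12 hHδ hlog hD hm₀.le
      (Nat.floor_le (by positivity)) (by positivity) ?_
    · exact_mod_cast Fintype.card_pos (α := X × A)
    · exact (toNat_log_sub_le (by positivity) hκ0).trans
        (mul_le_mul_of_nonneg_left (div_threshold_le hL hlam hT' hH' hα2) (by norm_num))
    · exact (Nat.ceil_lt_add_one (by positivity)).le
    · have h1 := (Nat.cast_le (α := ℝ)).2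
        (card_bonusClass_le F B (Int.log 2 κ) (Int.log 2 (1 / α ^ 2)) nmax m)
      push_cast at h1
      exact h1
  · intro Ω mΩ μ _ 𝓖 z σ add w hw P hP hz hσm hσ hadd hp
    subst hw hP
    set P : Fin H → Params := fun h => ⟨T, H, N, C, B h, α, δ⟩ with hPdef
    set bad : Fin H → Set Ω := fun h => {ω | ¬ IsGoodPath (P h) (F h) full κ I nmax l
      (fun t => (z h t ω, σ h t ω)) (fun s => ω ∈ add h s)} with hbad
    have hsub : {ω | ¬ IsConsistentBonusFamily
        (bonusClass F B (Int.log 2 κ) (Int.log 2 (1 / α ^ 2)) nmax m) (Real.sqrt (804 * K)) lam 0 T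
        F (fun h t => (z h t ω, σ h t ω)) β
        (fun h t => subsampleBonus (F h) κ (B h) (subsample (P h) (F h) full
          (fun t => (z h t ω, σ h t ω)) (fun s => ω ∈ add h s) t))} ⊆
        ⋃ h ∈ Finset.univ, bad h := by
      intro ω hω
      by_contra hnot
      apply hω
      have hgood : ∀ h, IsGoodPath (P h) (F h) full κ I nmax l
          (fun t => (z h t ω, σ h t ω)) (fun s => ω ∈ add h s) := by
        intro h
        by_contra hh
        exact hnot (Set.mem_biUnion (Finset.mem_univ h) hh)
      refine ⟨fun h t ht fhat hfhat => ⟨?_, ?_, ?_, ?_⟩, ?_⟩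
      · refine subsampleBonus_mem_bonusClass (P := P h) hκ0 hα0 (fun s hs => hσ h s hs ω)
          (hgood h).cap (fun S hS => ?_) ht.le
        have h1 := card_added_le (hgood h) (hF h) hL hα0 (fun s hs => hσ h s hs ω) hlam (hBlam h)
          hκ hI2 hC hlog S hS
        refine Nat.le_floor (h1.trans ?_)
        change 4 * (C * (L ^ 2 + 8) * genEluderDim (F h) lam α T * ℓ) + l ≤ m₀ * D * ℓ
        have h2 : C * (L ^ 2 + 8) * genEluderDim (F h) lam α T * ℓ ≤
            C * (L ^ 2 + 8) * D * ℓ := by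
          have := hDh h
          gcongr
        have h3 : ℓ ≤ D * ℓ := le_mul_of_one_le_left (by linarith) hD
        rw [hm₀def]
        linarith
      · exact fun z => subsampleBonus_nonneg _ _ _ z
      · intro z₀ f hf hfn
        -- The sub-sampling radius `B h` is at least the oracle radius, so closeness at the latter
        -- implies closeness at the former.
        have hβ' := hβB h t ht
        refine subsampleBonus_dominates (hgood h) (hF h) hα0 (fun s hs => hσ h s hs ω) hlam
          (hBlam h) hI2 hC hlog hf hfhat ht (hfn.trans ?_) z₀
        exact pow_le_pow_left₀ hβ'.1 hβ'.2.1 2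
      · intro z₀
        have := subsampleBonus_le (hgood h) (hFn h) (hF h) hL hα0 (fun s hs => hσ h s hs ω) hlam
          (hBlam h) hκ hI2 hC hlog ht hK (hβB h t ht).2.2 z₀
        simpa using this
      · intro h t t' htt' _ z₀
        exact subsampleBonus_anti (hFn h) (subsample_le_of_le _ _ _ _ _ htt'.le) z₀
    have hbadle : ∀ h ∈ Finset.univ, μ.real (bad h) ≤ δ / H := by
      intro h _
      have h1 := measure_not_isGoodPath_le (P := P h) (F := F h) (full := full) (κ := κ) (l := l)
        (I := I) (nmax := nmax) (hz h) (hσm h) (fun t ht ω => hα0.trans_le (hσ h t ht ω)) (hadd h)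
        (hp h) (hlam.trans_le (hBlam h)) hC hlog
      refine h1.trans ?_
      rw [le_div_iff₀ (by linarith), mul_comm]
      exact failure_le hT' hH' hN (by positivity) (by exact_mod_cast hcard h) hG (by positivity)
        hIle hδ hδ12 hHδ (Nat.le_ceil _)
    have htotal : μ.real (⋃ h ∈ Finset.univ, bad h) ≤ δ := by
      refine (measureReal_biUnion_finset_le _ _).trans ((Finset.sum_le_sum hbadle).trans_eq ?_)
      rw [Finset.sum_const, Finset.card_univ, Fintype.card_fin, nsmul_eq_mul]
      field_simp
    refine (measure_mono hsub).trans ?_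
    rw [← ofReal_measureReal (measure_ne_top _ _)]
    exact ENNReal.ofReal_le_ofReal htotal
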